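/- Identify $\mathbb{C}(t)$ with a subfield of the field $\mathbb{C}((t))$ of formal Laurent series by expansion at $0$. Let $R\in\mathbb{C}(t)$ be a nonzero rational function, regular at $0$ with $R(0)=0$, such that no iterate $R^{\circ n}=R\circ\cdots\circ R$ ($n\ge 1$) is the identity, and let $\Phi_R$ be the field endomorphism $f(t)\mapsto f(R(t))$ of $\mathbb{C}((t))$. Put $\mathbb{F}=\mathbb{C}((t))$ if $R'(0)\neq 0$. If $R'(0)=0$, put $\mathbb{F}=\mathbb{C}((t))(\log t)$, where $\log t$ is transcendental over $\mathbb{C}((t))$; extend $\frac{d}{dt}$ to $\mathbb{F}$ by $\frac{d}{dt}\log t=\frac1t$, and, writing $R=r\,t^d(1+u)$ with $r\in\mathbb{C}\setminus\{0\}$, $d\geq 2$ and $u\in t\mathbb{C}[[t]]$, extend $\Phi_R$ to $\mathbb{F}$ by $\Phi_R(\log t)=d\log t+\log r+\sum_{n\geq 1}\frac{(-1)^{n+1}}{n}u^n$ for some choice of the complex logarithm $\log r$. An element $f$ of $\mathbb{F}$ is called differentially algebraic over $\mathbb{C}(t)$ if there are an integer $n\ge 0$ and a nonzero polynomial $P$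 in $n+1$ variables with coefficients in $\mathbb{C}(t)$ such that $P(f,f',\dots,f^{(n)})=0$, the derivatives being taken with respect to $\frac{d}{dt}$; otherwise $f$ is called differentially transcendental over $\mathbb{C}(t)$. Assume that there exists $\Psi\in\mathbb{F}$ with $\Phi_R(\Psi)=R'\,\Psi$ that is differentially transcendental over $\mathbb{C}(t)$. Let $b\in\mathbb{C}(t)$ and let $f\in\mathbb{C}((t))$ satisfy $\Phi_R(f)=f+b$. Then either $f\in\mathbb{C}(t)$, or $f$ is differentially transcendental over $\mathbb{C}(t)$. -/

import Mathlib

noncomputable section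

namespace IterFE

/-- Let `F` be an extension of `K` through `ι`, with a derivation `D`. An element `f` of `F` is
differentially algebraic over `K` if some nonzero polynomial over `K` in finitely many variables
vanishes at `(f, D f, …, Dⁿ f)`. -/
def DiffAlgebraic {K F : Type*} [Field K] [Field F] (ι : K →+* F) (D : F → F) (f : F) : Prop :=
  ∃ (n : ℕ) (P : MvPolynomial (Fin (n + 1)) K),
    P ≠ 0 ∧ MvPolynomial.eval₂ ι (fun i : Fin (n + 1) => D^[(i : ℕ)] f) P = 0

/-- Differential transcendence: the negation of differential algebraicity. -/
def DiffTranscendental {K F : Type*} [Field K] [Field F] (ι : K →+* F) (D : F → F) (f : F) :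
    Prop :=
  ¬ DiffAlgebraic ι D f

open scoped RatFunc in
/-- The inclusion of `ℂ(t)` in `ℂ((t))` by expansion at `0`. -/
def ratToLaurent : RatFunc ℂ →+* LaurentSeries ℂ :=
  algebraMap (RatFunc ℂ) (LaurentSeries ℂ)

/-- A Laurent series is rational if it is the expansion at `0` of an element of `ℂ(t)`. -/
def IsRational (f : LaurentSeries ℂ) : Prop :=
  ∃ q : RatFunc ℂ, ratToLaurent q = f

/-- The inclusion of power series in Laurent series. -/
abbrev toLaurent : PowerSeries ℂ →+* LaurentSeries ℂ := HahnSeries.ofPowerSeries ℤ ℂ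

/-- The `n`-th iterate `R ∘ ⋯ ∘ R` of a power series without constant term. -/
def iter (R : PowerSeries ℂ) (n : ℕ) : PowerSeries ℂ :=
  (fun g : PowerSeries ℂ => g.subst R)^[n] PowerSeries.X

/-- `f ↦ f(R(t))` from power series to Laurent series. -/
def compPower (R : PowerSeries ℂ) (h0 : PowerSeries.constantCoeff R = 0) :
    PowerSeries ℂ →+* LaurentSeries ℂ :=
  toLaurent.comp
    (PowerSeries.substAlgHom (R := ℂ) (PowerSeries.HasSubst.of_constantCoeff_zero' h0)).toRingHom

theorem compPower_apply (R : PowerSeries ℂ) (h0 : PowerSeries.constantCoeff R = 0)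
    (g : PowerSeries ℂ) : compPower R h0 g = toLaurent (g.subst R) := by
  have h := PowerSeries.coe_substAlgHom (R := ℂ) (PowerSeries.HasSubst.of_constantCoeff_zero' h0)
  exact congrArg toLaurent (congrFun h g)

theorem isUnit_compPower_X (R : PowerSeries ℂ) (h0 : PowerSeries.constantCoeff R = 0)
    (hne : R ≠ 0) : IsUnit (compPower R h0 PowerSeries.X) := by
  rw [compPower_apply, PowerSeries.subst_X (PowerSeries.HasSubst.of_constantCoeff_zero' h0)]
  exact isUnit_iff_ne_zero.mpr
    ((map_ne_zero_iff _ HahnSeries.ofPowerSeries_injective).mpr hne)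

/-- The endomorphism `Φ_R : f(t) ↦ f(R(t))` of `ℂ((t))`, for a nonzero power series `R` without
constant term: the unique extension of `f ↦ f(R(t))` from `ℂ[[t]]` to `ℂ((t)) = ℂ[[t]][t⁻¹]`. -/
def Phi (R : PowerSeries ℂ) (h0 : PowerSeries.constantCoeff R = 0) (hne : R ≠ 0) :
    LaurentSeries ℂ →+* LaurentSeries ℂ :=
  IsLocalization.Away.lift (S := LaurentSeries ℂ) (PowerSeries.X : PowerSeries ℂ)
    (isUnit_compPower_X R h0 hne)

/-- The derivation `d/dt` of `ℂ((t))`. -/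
def ddt (f : LaurentSeries ℂ) : LaurentSeries ℂ := LaurentSeries.derivative ℂ f

section AdjoinIndeterminate

variable {K : Type*} [Field K]

/-- The derivation of `K[T]` that extends `δ` and sends `T` to `s`. -/
def polyDeriv (δ : K → K) (s : K) (p : Polynomial K) : Polynomial K :=
  (p.sum fun n a => Polynomial.monomial n (δ a)) + Polynomial.C s * Polynomial.derivative p

/-- The derivation of `K(T)` that extends `δ` and sends `T` to `s`, by the quotient rule. -/
def ratDeriv (δ : K → K) (s : K) (F : RatFunc K) : RatFunc K :=
  (algebraMap (Polynomial K) (RatFunc K) (polyDeriv δ s F.num) *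
        algebraMap (Polynomial K) (RatFunc K) F.denom -
      algebraMap (Polynomial K) (RatFunc K) F.num *
        algebraMap (Polynomial K) (RatFunc K) (polyDeriv δ s F.denom)) /
    algebraMap (Polynomial K) (RatFunc K) F.denom ^ 2

/-- The endomorphism of `K[T]` that acts as `φ` on `K` and sends `T` to `α T + β`. -/
def polyEndo (φ : K →+* K) (α β : K) : Polynomial K →+* Polynomial K :=
  Polynomial.eval₂RingHom (Polynomial.C.comp φ)
    (Polynomial.C α * Polynomial.X + Polynomial.C β)

theorem polyEndo_injective (φ : K →+* K) {α : K} (hα : α ≠ 0) (β : K) :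
    Function.Injective (polyEndo φ α β) := by
  have hdeg : (Polynomial.C α * Polynomial.X + Polynomial.C β).natDegree = 1 :=
    Polynomial.natDegree_linear hα
  rw [injective_iff_map_eq_zero]
  intro p hp
  have hp' : (p.map φ).comp (Polynomial.C α * Polynomial.X + Polynomial.C β) = 0 := by
    rw [← hp]
    simp [polyEndo, Polynomial.comp, Polynomial.eval₂_map]
  rcases Polynomial.comp_eq_zero_iff.mp hp' with h | ⟨_, h⟩
  · exact (Polynomial.map_eq_zero_iff φ.injective).mp h
  · rw [h] at hdeg
    simp at hdeg

/-- The endomorphism of `K(T)` that acts as `φ` on `K` and sends `T` to `α T + β`, where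
`α ≠ 0`. -/
def ratEndo (φ : K →+* K) (α : K) (hα : α ≠ 0) (β : K) : RatFunc K →+* RatFunc K :=
  RatFunc.mapRingHom (polyEndo φ α β)
    (nonZeroDivisors_le_comap_nonZeroDivisors_of_injective _ (polyEndo_injective φ hα β))

/-- The field `K(T)`. -/
abbrev AdjoinT (K : Type*) [Field K] : Type _ := RatFunc K

/-- The inclusion of `K` in `K(T)`. -/
def baseToAdjoinT (K : Type*) [Field K] : K →+* AdjoinT K := RatFunc.C

end AdjoinIndeterminate

/-- The field `ℂ((t))(log t)`: rational functions over `ℂ((t))` in the indeterminate `log t`. -/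
abbrev LogField : Type := AdjoinT (LaurentSeries ℂ)

/-- The inclusion of `ℂ((t))` in `ℂ((t))(log t)`. -/
def toLog : LaurentSeries ℂ →+* LogField := baseToAdjoinT (LaurentSeries ℂ)

/-- The derivation `d/dt` of `ℂ((t))(log t)`, with `d(log t)/dt = t⁻¹`. -/
def ddtLog : LogField → LogField := ratDeriv ddt (HahnSeries.single (-1 : ℤ) (1 : ℂ))

/-- The order of vanishing `d` of `R` at `0`. -/
def ord (R : PowerSeries ℂ) : ℕ := R.order.toNat

/-- The leading coefficient `r` in `R = r t ^ d + ⋯`. -/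
def leadCoeff (R : PowerSeries ℂ) : ℂ := PowerSeries.coeff (ord R) R

theorem ord_cast_ne_zero (R : PowerSeries ℂ) (h0 : PowerSeries.constantCoeff R = 0)
    (hne : R ≠ 0) : (HahnSeries.C (ord R : ℂ) : LaurentSeries ℂ) ≠ 0 := by
  rw [Ne, map_eq_zero_iff _ HahnSeries.C_injective, Nat.cast_eq_zero]
  intro h
  have h1 : PowerSeries.coeff (ord R) R ≠ 0 := PowerSeries.coeff_order hne
  rw [h] at h1
  exact h1 (by simpa using h0)

/-- The Laurent series part `l + log (R(t) / (r t ^ d))` of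
`log (R(t)) = d log t + l + log (R(t) / (r t ^ d))`, where `l` is a logarithm of `r` and the
last term is the formal power series `log (1 + u) = u - u² / 2 + ⋯`. -/
def logRest (R : PowerSeries ℂ) (l : ℂ) : LaurentSeries ℂ :=
  HahnSeries.C l +
    toLaurent (PowerSeries.logOf (PowerSeries.C (leadCoeff R)⁻¹ * R.divXPowOrder))

/-- The extension of `Φ_R` to `ℂ((t))(log t)` with
`Φ_R(log t) = log (R(t)) = d log t + l + log (R(t) / (r t ^ d))`. The logarithm `l` of the leading
coefficient `r` of `R` is the choice of a branch. -/
def PhiLog (R : PowerSeries ℂ) (h0 : PowerSeries.constantCoeff R = 0) (hne : R ≠ 0) (l : ℂ) :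
    LogField →+* LogField :=
  ratEndo (Phi R h0 hne) (HahnSeries.C (ord R : ℂ)) (ord_cast_ne_zero R h0 hne) (logRest R l)

end IterFE

end

noncomputable section

namespace IterFE

section

open MvPolynomial

section InvariantPolynomials

variable {I L : Type*} [Field L]

/-- The endomorphism `P ↦ P^σ(X + b)` of `L[X_i]`. -/
def shiftEndo (σ : L →+* L) (b : I → L) : MvPolynomial I L →+* MvPolynomial I L :=
  eval₂Hom (C.comp σ) fun i => X i + C (b i)

@[simp]
theorem shiftEndo_C (σ : L →+* L) (b : I → L) (a : L) : shiftEndo σ b (C a) = C (σ a) := by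
  simp [shiftEndo]

@[simp]
theorem shiftEndo_X (σ : L →+* L) (b : I → L) (i : I) :
    shiftEndo σ b (X i) = X i + C (b i) := by
  simp [shiftEndo]

theorem pderiv_shiftEndo (σ : L →+* L) (b : I → L) (i : I) (P : MvPolynomial I L) :
    pderiv i (shiftEndo σ b P) = shiftEndo σ b (pderiv i P) := by
  classical
  induction P using MvPolynomial.induction_on with
  | C a => simp
  | add p q hp hq => simp [hp, hq]
  | mul_X p j hp =>
    rw [map_mul, pderiv_mul, pderiv_mul, map_add, map_mul, map_mul, hp, shiftEndo_X, map_add,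
      pderiv_C, add_zero, pderiv_X]
    congr 2
    by_cases h : j = i
    · subst h; simp
    · simp [h]

theorem aeval_shiftEndo {F : Type*} [Field F] [Algebra L F] {σ : L →+* L} {φ : F →+* F}
    (hφ : ∀ a, φ (algebraMap L F a) = algebraMap L F (σ a)) {x : I → F} {b : I → L}
    (hx : ∀ i, φ (x i) = x i + algebraMap L F (b i)) (P : MvPolynomial I L) :
    aeval x (shiftEndo σ b P) = φ (aeval x P) := by
  induction P using MvPolynomial.induction_on with
  | C a => simp [hφ]
  | add p q hp hq => simp [hp, hq]
  | mul_X p j hp => simp [hp, hx]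

theorem totalDegree_pderiv_le (i : I) (P : MvPolynomial I L) :
    (pderiv i P).totalDegree ≤ P.totalDegree - 1 := by
  classical
  refine Finset.sup_le fun s hs => ?_
  rw [mem_support_iff, coeff_pderiv] at hs
  have h1 : s + Finsupp.single i 1 ∈ P.support := by
    rw [mem_support_iff]
    intro h
    simp [h] at hs
  have h2 := le_totalDegree h1
  rw [Finsupp.sum_add_index' (by simp) (by simp)] at h2
  simp only [Finsupp.sum_single_index] at h2
  omega

variable [CharZero L]

theorem coeff_shiftEndo_of_totalDegree_le (σ : L →+* L) (b : I → L) (n : ℕ) :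
    ∀ (s : I →₀ ℕ) (P : MvPolynomial I L), s.degree = n → P.totalDegree ≤ n →
      coeff s (shiftEndo σ b P) = σ (coeff s P) := by
  classical
  induction n with
  | zero =>
    intro s P hs hP
    obtain rfl : s = 0 := (Finsupp.degree_eq_zero_iff s).mp hs
    rw [totalDegree_eq_zero_iff_eq_C.mp (Nat.le_zero.mp hP)]
    simp
  | succ n ih =>
    intro s P hs hP
    obtain ⟨i, hi⟩ : ∃ i, s i ≠ 0 := by
      by_contra! h
      have : s = 0 := Finsupp.ext h
      simp [this] at hs
    have hle : Finsupp.single i 1 ≤ s := by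
      rw [Finsupp.single_le_iff]
      omega
    obtain ⟨t, rfl⟩ := exists_add_of_le hle
    rw [add_comm] at hs ⊢
    have ht : t.degree = n := by
      rw [map_add] at hs
      simp at hs
      exact hs
    have h := ih t (pderiv i P) ht ((totalDegree_pderiv_le i P).trans (by omega))
    rw [← pderiv_shiftEndo, coeff_pderiv, coeff_pderiv, map_mul, map_add, map_natCast,
      map_one] at h
    exact mul_right_cancel₀ (Nat.cast_add_one_ne_zero _) h

theorem totalDegree_shiftEndo_le (σ : L →+* L) (b : I → L) (P : MvPolynomial I L) :
    (shiftEndo σ b P).totalDegree ≤ P.totalDegree := by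
  refine Finset.sup_le fun s hs => ?_
  by_contra! h
  rw [mem_support_iff] at hs
  apply hs
  have hs' : (s.sum fun _ e => e) = s.degree := rfl
  rw [hs'] at h
  rw [coeff_shiftEndo_of_totalDegree_le σ b s.degree s P rfl h.le, notMem_support_iff.mp, map_zero]
  intro hmem
  have := le_totalDegree hmem
  omega

/-- An ideal of `L[X_i]` that is stable under `P ↦ P^σ(X + b)`, proper and nonzero, contains a
nonconstant invariant polynomial. -/
theorem exists_invariant_of_ideal (σ : L →+* L) (b : I → L) (J : Ideal (MvPolynomial I L))
    (hJ : J ≠ ⊤) (hJ0 : J ≠ ⊥) (hst : ∀ P ∈ J, shiftEndo σ b P ∈ J) :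
    ∃ P : MvPolynomial I L, P.totalDegree ≠ 0 ∧ shiftEndo σ b P = P := by
  classical
  let top : MvPolynomial I L → Finset (I →₀ ℕ) := fun P =>
    P.support.filter fun s => s.degree = P.totalDegree
  have hex : ∃ P : MvPolynomial I L, P ∈ J ∧ P ≠ 0 := by
    by_contra! h
    exact hJ0 ((Submodule.eq_bot_iff _).mpr h)
  let μ : MvPolynomial I L → ℕ ×ₗ ℕ := fun P => toLex (P.totalDegree, (top P).card)
  obtain ⟨P, ⟨hPJ, hP0⟩, hmin⟩ :=
    (InvImage.wf μ wellFounded_lt).has_min {P : MvPolynomial I L | P ∈ J ∧ P ≠ 0} hex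
  have hdeg : P.totalDegree ≠ 0 := by
    intro h
    rw [totalDegree_eq_zero_iff_eq_C.mp h] at hPJ hP0
    exact hJ (Ideal.eq_top_of_isUnit_mem _ hPJ
      ((isUnit_iff_ne_zero.mpr (by rintro h; simp [h] at hP0)).map C))
  obtain ⟨s, hs, hsdeg⟩ : ∃ s ∈ P.support, s.degree = P.totalDegree := by
    obtain ⟨s, hs, h⟩ := Finset.exists_mem_eq_sup P.support (support_nonempty.mpr hP0)
      (fun s => s.degree)
    exact ⟨s, hs, h.symm⟩
  have hc : coeff s P ≠ 0 := mem_support_iff.mp hs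
  set c := (coeff s P)⁻¹ with hcdef
  have hc0 : c ≠ 0 := inv_ne_zero hc
  have hsupp : (C c * P).support = P.support := by
    ext t
    simp [mem_support_iff, coeff_C_mul, hc0]
  have hdegc : (C c * P).totalDegree = P.totalDegree := by
    simp only [totalDegree, hsupp]
  refine ⟨C c * P, by rwa [hdegc], ?_⟩
  by_contra hne
  set Q := shiftEndo σ b (C c * P) - C c * P with hQ
  have hQ0 : Q ≠ 0 := sub_ne_zero.mpr hne
  have hcPJ : C c * P ∈ J := J.mul_mem_left _ hPJ
  have hQJ : Q ∈ J := J.sub_mem (hst _ hcPJ) hcPJ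
  have hQdeg : Q.totalDegree ≤ P.totalDegree := by
    refine (totalDegree_sub _ _).trans (max_le ?_ hdegc.le)
    exact (totalDegree_shiftEndo_le σ b _).trans hdegc.le
  have hcoeff : ∀ t : I →₀ ℕ, t.degree = P.totalDegree →
      coeff t Q = σ (coeff t (C c * P)) - coeff t (C c * P) := by
    intro t ht
    rw [hQ, coeff_sub, coeff_shiftEndo_of_totalDegree_le σ b t.degree t _ rfl (by
      rw [hdegc, ht])]
  refine hmin Q ⟨hQJ, hQ0⟩ ?_
  change toLex (Q.totalDegree, (top Q).card) < toLex (P.totalDegree, (top P).card)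
  rw [Prod.Lex.toLex_lt_toLex]
  rcases hQdeg.lt_or_eq with h | h
  · exact Or.inl h
  refine Or.inr ⟨h, Finset.card_lt_card ?_⟩
  rw [Finset.ssubset_iff_of_subset]
  · refine ⟨s, by simp [top, mem_support_iff, hc, hsdeg], ?_⟩
    simp only [top, Finset.mem_filter, mem_support_iff, not_and]
    intro h1
    rw [hcoeff s hsdeg, coeff_C_mul, hcdef, inv_mul_cancel₀ hc] at h1
    simp at h1
  · intro t ht
    simp only [top, Finset.mem_filter, mem_support_iff] at ht ⊢
    refine ⟨?_, ht.2.trans h⟩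
    intro h1
    apply ht.1
    rw [hcoeff t (ht.2.trans h), coeff_C_mul, h1]
    simp

/-- A nonconstant invariant polynomial gives rise to an invariant polynomial of degree one. -/
theorem exists_affine_invariant (σ : L →+* L) (b : I → L)
    (h : ∃ P : MvPolynomial I L, P.totalDegree ≠ 0 ∧ shiftEndo σ b P = P) :
    ∃ (c : I →₀ L) (a : L), c ≠ 0 ∧ (∀ i, σ (c i) = c i) ∧
      shiftEndo σ b ((c.sum fun i z => C z * X i) + C a) = (c.sum fun i z => C z * X i) + C a := by
  classical
  obtain ⟨P, ⟨hP, hinv⟩, hmin⟩ :=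
    (InvImage.wf (fun P : MvPolynomial I L => P.totalDegree) wellFounded_lt).has_min
      {P : MvPolynomial I L | P.totalDegree ≠ 0 ∧ shiftEndo σ b P = P} h
  have hpd : ∀ i, (pderiv i P).totalDegree = 0 := by
    intro i
    by_contra hne
    refine hmin (pderiv i P) ⟨hne, by rw [← pderiv_shiftEndo, hinv]⟩ ?_
    have := totalDegree_pderiv_le i P
    change (pderiv i P).totalDegree < P.totalDegree
    omega
  have hcoeff : ∀ (s : I →₀ ℕ) (i : I), s ≠ 0 → coeff (s + Finsupp.single i 1) P = 0 := by
    intro s i hs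
    have h1 : coeff s (pderiv i P) = 0 := by
      rw [totalDegree_eq_zero_iff_eq_C.mp (hpd i), coeff_C, if_neg hs.symm]
    rw [coeff_pderiv] at h1
    exact (mul_eq_zero.mp h1).resolve_right (Nat.cast_add_one_ne_zero _)
  let c : I →₀ L := Finsupp.ofSupportFinite (fun i => coeff (Finsupp.single i 1) P)
    ((P.support.finite_toSet.preimage
      (Finsupp.single_left_injective (one_ne_zero : (1 : ℕ) ≠ 0)).injOn).subset fun i hi => by
        simpa [mem_support_iff] using hi)
  have hc : ∀ i, c i = coeff (Finsupp.single i 1) P := fun i => rfl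
  have hlin : ∀ s : I →₀ ℕ, s ≠ 0 → (∀ i, s ≠ Finsupp.single i 1) → coeff s P = 0 := by
    intro s hs0 hs1
    obtain ⟨i, hi⟩ : ∃ i, s i ≠ 0 := by
      by_contra! h
      exact hs0 (Finsupp.ext h)
    have hle : Finsupp.single i 1 ≤ s := by
      rw [Finsupp.single_le_iff]
      omega
    obtain ⟨t, rfl⟩ := exists_add_of_le hle
    rw [add_comm]
    exact hcoeff t i (by rintro rfl; exact hs1 i (add_zero _))
  have hPeq : P = (c.sum fun i z => C z * X i) + C (coeff 0 P) := by
    ext s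
    rw [coeff_add, Finsupp.sum, coeff_sum]
    simp only [coeff_C_mul, coeff_X, coeff_C]
    by_cases hs0 : s = 0
    · subst hs0
      simp
    by_cases hs1 : ∃ i, s = Finsupp.single i 1
    · obtain ⟨i, rfl⟩ := hs1
      simp only [Finsupp.single_left_inj (one_ne_zero : (1 : ℕ) ≠ 0), mul_ite, mul_one, mul_zero,
        Finset.sum_ite_eq', Finsupp.mem_support_iff, hc, if_neg (Ne.symm hs0), add_zero]
      split_ifs with h1
      · rfl
      · exact not_not.mp h1
    · push Not at hs1
      rw [hlin s hs0 hs1, if_neg (Ne.symm hs0), add_zero]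
      refine (Finset.sum_eq_zero fun i _ => ?_).symm
      rw [if_neg (hs1 i).symm, mul_zero]
  refine ⟨c, coeff 0 P, ?_, ?_, ?_⟩
  · intro hc0
    apply hP
    rw [hPeq, hc0]
    simp
  · intro i
    have h1 : pderiv i P = C (c i) := by
      rw [totalDegree_eq_zero_iff_eq_C.mp (hpd i), coeff_pderiv, hc]
      simp
    have h2 := pderiv_shiftEndo σ b i P
    rw [hinv, h1, shiftEndo_C] at h2
    exact (C_injective _ _ h2).symm
  · rw [← hPeq, hinv]

/-- If `φ(x i) - x i` lies in `L` for all `i` and the `x i` are algebraically dependent over `L`,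
then some nontrivial linear combination of the `x i` with `φ`-invariant coefficients is
`φ`-invariant up to an element of `L`. -/
theorem exists_linear_invariant {F : Type*} [Field F] [Algebra L F] {σ : L →+* L} {φ : F →+* F}
    (hφ : ∀ a, φ (algebraMap L F a) = algebraMap L F (σ a)) {x : I → F} {b : I → L}
    (hx : ∀ i, φ (x i) = x i + algebraMap L F (b i)) (hdep : ¬ AlgebraicIndependent L x) :
    ∃ (c : I →₀ L) (a : L), c ≠ 0 ∧ (∀ i, σ (c i) = c i) ∧
      φ ((c.sum fun i z => algebraMap L F z * x i) + algebraMap L F a) =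
        (c.sum fun i z => algebraMap L F z * x i) + algebraMap L F a := by
  let J : Ideal (MvPolynomial I L) := RingHom.ker (aeval x : MvPolynomial I L →ₐ[L] F)
  have hbot : J ≠ ⊥ := fun h => hdep ((injective_iff_map_eq_zero _).mpr fun P hP => by
    have : P ∈ J := hP
    rwa [h] at this)
  have hst : ∀ P ∈ J, shiftEndo σ b P ∈ J := by
    intro P hP
    have hP' : aeval x P = 0 := hP
    change aeval x _ = 0
    rw [aeval_shiftEndo hφ hx, hP', map_zero]
  obtain ⟨c, a, hc, hσ, hinv⟩ := exists_affine_invariant σ b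
    (exists_invariant_of_ideal σ b J (RingHom.ker_ne_top _) hbot hst)
  refine ⟨c, a, hc, hσ, ?_⟩
  have h := aeval_shiftEndo hφ hx ((c.sum fun i z => C z * X i) + C a)
  rw [hinv] at h
  simpa [Finsupp.sum] using h.symm

end InvariantPolynomials

end

section

open MvPolynomial IntermediateField

section DifferentialFields

variable {K F : Type*} [Field K] [Field F] [Algebra K F]

theorem deriv_mem_of_mem_adjoin {D : Derivation ℤ F F} {s : Set F} {E : IntermediateField K F}
    (hK : ∀ a : K, D (algebraMap K F a) ∈ E) (hs : ∀ x ∈ s, x ∈ E) (hDs : ∀ x ∈ s, D x ∈ E)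
    {x : F} (hx : x ∈ adjoin K s) : D x ∈ E := by
  have hle : adjoin K s ≤ E := adjoin_le_iff.mpr hs
  induction hx using adjoin_induction with
  | mem x hx => exact hDs x hx
  | algebraMap x => exact hK x
  | add x y _ _ hx hy => rw [map_add]; exact E.add_mem hx hy
  | inv x h hx =>
    rw [Derivation.leibniz_inv, smul_eq_mul, neg_mul]
    exact E.neg_mem (E.mul_mem (pow_mem (E.inv_mem (hle h)) 2) hx)
  | mul x y h h' hx hy =>
    rw [Derivation.leibniz, smul_eq_mul, smul_eq_mul]
    exact E.add_mem (E.mul_mem (hle h) hy) (E.mul_mem (hle h') hx)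

theorem deriv_mem_of_isAlgebraic [CharZero K] {D : Derivation ℤ F F} {E E' : IntermediateField K F}
    (hE : E ≤ E') (hD : ∀ x ∈ E, D x ∈ E') {α : F} (hα : α ∈ E') (halg : IsAlgebraic E α) :
    D α ∈ E' := by
  have key : ∀ p : Polynomial E, ∃ e ∈ E',
      D (Polynomial.aeval α p) = e + Polynomial.aeval α p.derivative * D α := by
    intro p
    induction p using Polynomial.induction_on' with
    | add p q hp hq =>
      obtain ⟨e, he, h⟩ := hp
      obtain ⟨e', he', h'⟩ := hq
      refine ⟨e + e', E'.add_mem he he', ?_⟩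
      simp only [map_add, h, h']
      ring
    | monomial n a =>
      refine ⟨D a * α ^ n, E'.mul_mem (hD a a.2) (pow_mem hα n), ?_⟩
      simp only [Polynomial.aeval_monomial, Polynomial.derivative_monomial, Derivation.leibniz,
        Derivation.leibniz_pow, smul_eq_mul, map_mul, map_natCast, nsmul_eq_mul]
      change (a : F) * _ + α ^ n * D a = _ + (a : F) * n * _ * _
      ring
  have haE : ∀ p : Polynomial E, Polynomial.aeval α p ∈ E' := by
    intro p
    rw [Polynomial.aeval_eq_sum_range]
    exact sum_mem fun i _ => E'.mul_mem (hE (p.coeff i).2) (pow_mem hα i)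
  have hint : IsIntegral E α := halg.isIntegral
  obtain ⟨e, he, h⟩ := key (minpoly E α)
  have hne : Polynomial.aeval α (minpoly E α).derivative ≠ 0 :=
    (minpoly.irreducible hint).separable.aeval_derivative_ne_zero (minpoly.aeval E α)
  rw [minpoly.aeval, map_zero] at h
  have hval : D α = -e / Polynomial.aeval α (minpoly E α).derivative := by
    rw [eq_div_iff hne]
    linear_combination -h
  rw [hval]
  exact E'.div_mem (E'.neg_mem he) (haE _)

theorem exists_isAlgebraic_adjoin_image_Iio {u : ℕ → F} (hu : ¬ AlgebraicIndependent K u) :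
    ∃ n, IsAlgebraic (adjoin K (u '' Set.Iio n)) (u n) := by
  by_contra! h
  refine hu (algebraicIndependent_of_finite_type fun t ht => ?_)
  have key : ∀ n, AlgebraicIndepOn K u (Set.Iio n) := by
    intro n
    induction n with
    | zero =>
      have : IsEmpty (Set.Iio 0 : Set ℕ) := by simp
      exact algebraicIndependent_empty_type_iff.mpr (algebraMap K F).injective
    | succ n ih =>
      have : Set.Iio (n + 1) = insert n (Set.Iio n) := by
        ext; simp
      rw [this]
      refine ih.insert fun halg => h n ?_
      obtain ⟨p, hp0, hp⟩ := halg
      have hle : Algebra.adjoin K (u '' Set.Iio n) ≤ (adjoin K (u '' Set.Iio n)).toSubalgebra :=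
        algebra_adjoin_le_adjoin K _
      let j : Algebra.adjoin K (u '' Set.Iio n) →+* adjoin K (u '' Set.Iio n) :=
        (Subalgebra.inclusion hle).toRingHom
      have hj : Function.Injective j := Subalgebra.inclusion_injective hle
      refine ⟨p.map j, (Polynomial.map_ne_zero_iff hj).mpr hp0, ?_⟩
      rw [Polynomial.aeval_def, Polynomial.eval₂_map]
      exact hp
  obtain ⟨n, hn⟩ := ht.bddAbove
  exact (key (n + 1)).mono (fun i hi => Nat.lt_succ_of_le (hn hi))

/-- A differentially algebraic element lies in a finitely generated differential field. -/
theorem exists_fg_differential_field [CharZero K] {D : Derivation ℤ F F}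
    (hK : ∀ a : K, ∃ a' : K, D (algebraMap K F a) = algebraMap K F a') {f : F}
    (hf : ¬ AlgebraicIndependent K fun i : ℕ => D^[i] f) :
    ∃ E : IntermediateField K F, E.FG ∧ (∀ x ∈ E, D x ∈ E) ∧ f ∈ E := by
  set u : ℕ → F := fun i => D^[i] f with hu
  have hDu : ∀ i, D (u i) = u (i + 1) := fun i => (Function.iterate_succ_apply' D i f).symm
  obtain ⟨n, hn⟩ := exists_isAlgebraic_adjoin_image_Iio hf
  have hKE : ∀ (E : IntermediateField K F) (a : K), D (algebraMap K F a) ∈ E := by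
    intro E a
    obtain ⟨a', ha'⟩ := hK a
    rw [ha']
    exact E.algebraMap_mem a'
  set E := adjoin K (u '' Set.Iio n) with hE
  set E' := adjoin K (u '' Set.Iio (n + 1)) with hE'
  have hmem : ∀ i, i < n + 1 → u i ∈ E' := fun i hi => subset_adjoin _ _ ⟨i, hi, rfl⟩
  have hle : E ≤ E' := adjoin.mono _ _ _ (Set.image_mono fun i (hi : i < n) => by
    simp; omega)
  have hDE : ∀ x ∈ E, D x ∈ E' := by
    intro x hx
    refine deriv_mem_of_mem_adjoin (hKE E') ?_ ?_ hx
    · rintro _ ⟨i, hi, rfl⟩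
      exact hmem i (Nat.lt_succ_of_lt hi)
    · rintro _ ⟨i, hi, rfl⟩
      rw [hDu]
      exact hmem (i + 1) (Nat.succ_lt_succ hi)
  have hDn : D (u n) ∈ E' := deriv_mem_of_isAlgebraic hle hDE (hmem n (Nat.lt_succ_self n)) hn
  refine ⟨E', fg_adjoin_of_finite ((Set.finite_Iio _).image _), ?_, ?_⟩
  · intro x hx
    refine deriv_mem_of_mem_adjoin (hKE E') ?_ ?_ hx
    · rintro _ ⟨i, hi, rfl⟩
      exact hmem i hi
    · rintro _ ⟨i, hi, rfl⟩
      rcases (Nat.lt_succ_iff.mp hi).lt_or_eq with h | rfl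
      · rw [hDu]
        exact hmem (i + 1) (Nat.succ_lt_succ h)
      · exact hDn
  · exact hmem 0 (Nat.succ_pos n)

theorem iterate_mem {D : F → F} {E : IntermediateField K F} (hD : ∀ x ∈ E, D x ∈ E) {f : F}
    (hf : f ∈ E) (i : ℕ) : D^[i] f ∈ E := by
  induction i with
  | zero => exact hf
  | succ i ih => rw [Function.iterate_succ_apply']; exact hD _ ih

theorem not_algebraicIndependent_of_mem_finTrdeg {E : IntermediateField K F} [FinTrdeg K E]
    {x : ℕ → F} (hx : ∀ i, x i ∈ E) : ¬ AlgebraicIndependent K x := by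
  intro h
  have h' : AlgebraicIndependent K (fun i => (⟨x i, hx i⟩ : E)) :=
    AlgebraicIndependent.of_comp E.val h
  have := finite_of_algebraicIndependent h'
  exact not_finite ℕ

theorem finTrdeg_of_fg {E : IntermediateField K F} (hE : E.FG) : FinTrdeg K E := by
  have := essFiniteType_iff.mpr hE
  infer_instance

/-- A differentially transcendental element stays so over a finitely generated differential
extension of the base field. -/
theorem algebraicIndependent_of_fg [CharZero K] {D : Derivation ℤ F F} {M : IntermediateField K F}
    (hM : M.FG) (hDM : ∀ x ∈ M, D x ∈ M) {Ψ : F}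
    (hΨ : AlgebraicIndependent K fun i : ℕ => D^[i] Ψ) :
    AlgebraicIndependent M fun i : ℕ => D^[i] Ψ := by
  by_contra h
  obtain ⟨E, hE, hDE, hΨE⟩ := exists_fg_differential_field (K := M)
    (fun a => ⟨⟨D a, hDM a a.2⟩, rfl⟩) h
  have := finTrdeg_of_fg hM
  have := finTrdeg_of_fg hE
  have : FinTrdeg K E := FinTrdeg.trans K M E
  have : FinTrdeg K (E.restrictScalars K) := this
  exact not_algebraicIndependent_of_mem_finTrdeg (E := E.restrictScalars K)
    (fun i => iterate_mem hDE hΨE i) hΨ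

end DifferentialFields

section Jets

/-- The derivation of `ℤ[Z₀, Z₁, …, Y₀, Y₁, …]` with `Zᵢ ↦ Zᵢ₊₁` and `Yᵢ ↦ Yᵢ₊₁`. -/
def jetDeriv : Derivation ℤ (MvPolynomial (ℕ ⊕ ℕ) ℤ) (MvPolynomial (ℕ ⊕ ℕ) ℤ) :=
  mkDerivation ℤ (Sum.elim (fun k => X (Sum.inl (k + 1))) fun j => X (Sum.inr (j + 1)))

/-- The polynomial that expresses `(Ψ D)ⁿ f` in terms of `Zᵢ = Dⁱ f` and `Yᵢ = Dⁱ Ψ`. -/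
def jet : ℕ → MvPolynomial (ℕ ⊕ ℕ) ℤ
  | 0 => X (Sum.inl 0)
  | n + 1 => X (Sum.inr 0) * jetDeriv (jet n)

theorem deriv_aeval_eq_aeval_jetDeriv {F : Type*} [Field F] (D : Derivation ℤ F F) (f Ψ : F)
    (P : MvPolynomial (ℕ ⊕ ℕ) ℤ) :
    D (aeval (Sum.elim (fun k => D^[k] f) fun j => D^[j] Ψ) P) =
      aeval (Sum.elim (fun k => D^[k] f) fun j => D^[j] Ψ) (jetDeriv P) := by
  induction P using MvPolynomial.induction_on with
  | C a => simp [jetDeriv]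
  | add p q hp hq => simp [hp, hq]
  | mul_X p i hp =>
    rw [map_mul, Derivation.leibniz, Derivation.leibniz, map_add, hp]
    simp only [smul_eq_mul, map_mul, aeval_X]
    congr 2
    rcases i with k | j
    · simp [jetDeriv, mkDerivation_X, Function.iterate_succ_apply' D]
    · simp [jetDeriv, mkDerivation_X, Function.iterate_succ_apply' D]

theorem aeval_jet {F : Type*} [Field F] (D : Derivation ℤ F F) (f Ψ : F) (n : ℕ) :
    aeval (Sum.elim (fun k => D^[k] f) fun j => D^[j] Ψ) (jet n) = (fun z => Ψ * D z)^[n] f := by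
  induction n with
  | zero => simp [jet]
  | succ n ih =>
    rw [Function.iterate_succ_apply', ← ih, jet, map_mul, deriv_aeval_eq_aeval_jetDeriv]
    simp

theorem pderiv_succ_jetDeriv (j : ℕ) (P : MvPolynomial (ℕ ⊕ ℕ) ℤ) :
    pderiv (Sum.inr (j + 1)) (jetDeriv P) =
      jetDeriv (pderiv (Sum.inr (j + 1)) P) + pderiv (Sum.inr j) P := by
  classical
  induction P using MvPolynomial.induction_on with
  | C a => simp [jetDeriv]
  | add p q hp hq => simp only [map_add, hp, hq]; ring
  | mul_X p i hp =>
    have h1 : pderiv (Sum.inr (j + 1)) (jetDeriv (X i)) = pderiv (Sum.inr j) (X i) := by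
      rcases i with k | i
      · simp [jetDeriv, mkDerivation_X, pderiv_X]
      · simp [jetDeriv, mkDerivation_X, pderiv_X, Pi.single_apply]
    have h2 : jetDeriv (pderiv (Sum.inr (j + 1)) (X i)) = 0 := by
      rw [pderiv_X]
      by_cases h : i = Sum.inr (j + 1) <;> simp [h]
    simp only [Derivation.leibniz, smul_eq_mul, map_add, hp, h1, h2]
    ring

theorem pderiv_jet_of_le {n j : ℕ} (h : n ≤ j) : pderiv (Sum.inr j) (jet n) = 0 := by
  classical
  induction n generalizing j with
  | zero => simp [jet, pderiv_X]
  | succ n ih =>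
    obtain ⟨j, rfl⟩ : ∃ i, j = i + 1 := ⟨j - 1, by omega⟩
    rw [jet, pderiv_mul, pderiv_succ_jetDeriv, ih (by omega), ih (by omega)]
    simp [pderiv_X]

theorem pderiv_jet_succ (n : ℕ) :
    pderiv (Sum.inr n) (jet (n + 1)) = X (Sum.inr 0) ^ n * X (Sum.inl 1) := by
  classical
  induction n with
  | zero => simp [jet, pderiv_X, jetDeriv, mkDerivation_X]
  | succ n ih =>
    rw [jet, pderiv_mul, pderiv_succ_jetDeriv, ih, pderiv_jet_of_le le_rfl]
    simp [pderiv_X]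
    ring

/-- The specialization of the variables `Zᵢ` to elements of a ring. -/
def jetSpecialize {M : Type*} [CommRing M] (z : ℕ → M) :
    MvPolynomial (ℕ ⊕ ℕ) ℤ →ₐ[ℤ] MvPolynomial ℕ M :=
  aeval (Sum.elim (fun k => C (z k)) X)

theorem pderiv_jetSpecialize {M : Type*} [CommRing M] (z : ℕ → M) (j : ℕ)
    (P : MvPolynomial (ℕ ⊕ ℕ) ℤ) :
    pderiv j (jetSpecialize z P) = jetSpecialize z (pderiv (Sum.inr j) P) := by
  classical
  induction P using MvPolynomial.induction_on with
  | C a => simp [jetSpecialize]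
  | add p q hp hq => simp [hp, hq]
  | mul_X p i hp =>
    have h : pderiv j (jetSpecialize z (X i)) = jetSpecialize z (pderiv (Sum.inr j) (X i)) := by
      rcases i with k | i
      · simp [jetSpecialize, pderiv_X]
      · by_cases h : i = j <;> simp [jetSpecialize, pderiv_X, h]
    simp only [map_mul, pderiv_mul, map_add, hp, h]

theorem aeval_jetSpecialize {M F : Type*} [Field M] [Field F] [Algebra M F] (z : ℕ → M)
    (y : ℕ → F) (P : MvPolynomial (ℕ ⊕ ℕ) ℤ) :
    aeval y (jetSpecialize z P) = aeval (Sum.elim (fun k => algebraMap M F (z k)) y) P := by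
  induction P using MvPolynomial.induction_on with
  | C a => simp [jetSpecialize]
  | add p q hp hq => simp [hp, hq]
  | mul_X p i hp =>
    rw [map_mul, map_mul, map_mul, hp]
    rcases i with k | i <;> simp [jetSpecialize]

/-- A polynomial over an extension field of `K` that is a quotient of two polynomials over `K`
has its coefficients in `K`. -/
theorem coeff_mem_range_of_map_mul_eq_map {K M I : Type*} [Field K] [Field M] [Algebra K M]
    {p q : MvPolynomial I K} {G : MvPolynomial I M} (hp : p ≠ 0)
    (h : map (algebraMap K M) p * G = map (algebraMap K M) q) (s : I →₀ ℕ) :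
    coeff s G ∈ Set.range (algebraMap K M) := by
  classical
  by_contra hs
  have hs' : coeff s G ∉ Submodule.span K {(1 : M)} := by
    rw [Submodule.mem_span_singleton]
    rintro ⟨a, ha⟩
    exact hs ⟨a, by rw [← ha, Algebra.algebraMap_eq_smul_one]⟩
  obtain ⟨π, hπs, hπ⟩ := Submodule.exists_le_ker_of_notMem hs'
  have hπ1 : π 1 = 0 := hπ (Submodule.mem_span_singleton_self 1)
  have hπK : ∀ a : K, π (algebraMap K M a) = 0 := by
    intro a
    rw [Algebra.algebraMap_eq_smul_one, map_smul, hπ1, smul_zero]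
  let G' : MvPolynomial I K := ∑ t ∈ G.support, monomial t (π (coeff t G))
  have hG' : ∀ t, coeff t G' = π (coeff t G) := by
    intro t
    simp only [G', coeff_sum, coeff_monomial, Finset.sum_ite_eq', mem_support_iff]
    split_ifs with h0
    · rfl
    · rw [not_not.mp h0, map_zero]
  have hzero : p * G' = 0 := by
    ext t
    have ht := congrArg (fun P => π (coeff t P)) h
    simp only [coeff_mul, coeff_map, map_sum, hπK] at ht
    rw [coeff_mul, coeff_zero, ← ht]
    refine Finset.sum_congr rfl fun x _ => ?_
    rw [hG', ← Algebra.smul_def, map_smul, smul_eq_mul]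
  have : G' = 0 := (mul_eq_zero.mp hzero).resolve_left hp
  apply hπs
  rw [← hG', this, coeff_zero]

end Jets

end

section

open MvPolynomial IntermediateField

section Main

variable {K F : Type*} [Field K] [Field F] [Algebra K F] [CharZero K]

/-- If a combination of the `(Ψ D)ⁿ f` with coefficients in `K` is a rational function over `K` of
the derivatives of `Ψ`, and `Ψ` is differentially transcendental over a differential field that
contains `f`, then `f` or `D f` lies in `K`. -/
theorem mem_or_deriv_mem_of_sum_mem {D : Derivation ℤ F F} {M : IntermediateField K F}
    (hDM : ∀ x ∈ M, D x ∈ M) {f Ψ : F} (hfM : f ∈ M)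
    (hΨ : AlgebraicIndependent M fun i : ℕ => D^[i] Ψ) {c : ℕ →₀ K} (hc : c ≠ 0)
    (hsum : (c.sum fun i a => algebraMap K F a * (fun z => Ψ * D z)^[i] f) ∈
      adjoin K (Set.range fun i : ℕ => D^[i] Ψ)) :
    f ∈ Set.range (algebraMap K F) ∨ D f ∈ Set.range (algebraMap K F) := by
  classical
  let z : ℕ → M := fun k => ⟨D^[k] f, iterate_mem hDM hfM k⟩
  let G : MvPolynomial ℕ M := c.sum fun i a => C (algebraMap K M a) * jetSpecialize z (jet i)
  have hG : aeval (fun i : ℕ => D^[i] Ψ) G =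
      c.sum fun i a => algebraMap K F a * (fun z => Ψ * D z)^[i] f := by
    simp only [G, Finsupp.sum, map_sum, map_mul, aeval_jetSpecialize]
    refine Finset.sum_congr rfl fun i _ => ?_
    rw [← aeval_jet, aeval_C, ← IsScalarTower.algebraMap_apply]
    rfl
  obtain ⟨q, p, hqp⟩ := (mem_adjoin_range_iff K _ _).mp hsum
  have hmap : ∀ P : MvPolynomial ℕ K,
      aeval (fun i : ℕ => D^[i] Ψ) (map (algebraMap K M) P) =
        aeval (fun i : ℕ => D^[i] Ψ) P := fun P => aeval_map_algebraMap M _ P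
  have hrange : ∀ s, coeff s G ∈ Set.range (algebraMap K M) := by
    intro s
    by_cases hp : aeval (fun i : ℕ => D^[i] Ψ) p = 0
    · rw [hp, div_zero, ← hG] at hqp
      have : G = 0 := hΨ (by rw [hqp, map_zero])
      rw [this, coeff_zero]
      exact ⟨0, map_zero _⟩
    · refine coeff_mem_range_of_map_mul_eq_map (p := p) (q := q) ?_ ?_ s
      · rintro rfl
        exact hp (map_zero _)
      · apply hΨ
        change aeval _ _ = aeval _ _
        rw [map_mul, hmap, hmap, hG, hqp, mul_div_cancel₀ _ hp]
  have hlift : ∀ x : M, x ∈ Set.range (algebraMap K M) →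
      (x : F) ∈ Set.range (algebraMap K F) := by
    rintro _ ⟨a, rfl⟩
    exact ⟨a, rfl⟩
  have hcancel : ∀ (a : K) (x : M), a ≠ 0 → algebraMap K M a * x ∈ Set.range (algebraMap K M) →
      x ∈ Set.range (algebraMap K M) := by
    rintro a x ha ⟨e, he⟩
    have ha' : algebraMap K M a ≠ 0 := (map_ne_zero _).mpr ha
    exact ⟨e / a, by rw [map_div₀, he, mul_div_cancel_left₀ _ ha']⟩
  have hne : c.support.Nonempty := Finsupp.support_nonempty_iff.mpr hc
  obtain ⟨N, hN, hmax⟩ : ∃ N ∈ c.support, ∀ i ∈ c.support, i ≤ N :=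
    ⟨c.support.max' hne, c.support.max'_mem hne, fun i hi => c.support.le_max' i hi⟩
  have hcN : c N ≠ 0 := Finsupp.mem_support_iff.mp hN
  rcases N with _ | m
  · left
    have hsupp : c.support = {0} := by
      ext i
      rw [Finset.mem_singleton]
      exact ⟨fun hi => Nat.le_zero.mp (hmax i hi), fun hi => hi ▸ hN⟩
    have hG0 : G = C (algebraMap K M (c 0) * z 0) := by
      simp only [G, Finsupp.sum, hsupp, Finset.sum_singleton]
      simp [jet, jetSpecialize]
    have h := hrange 0
    rw [hG0, coeff_C, if_pos rfl] at h
    exact hlift _ (hcancel _ _ hcN h)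
  · right
    have hpd : pderiv m G = C (algebraMap K M (c (m + 1)) * z 1) * X 0 ^ m := by
      simp only [G, Finsupp.sum, map_sum, pderiv_C_mul, pderiv_jetSpecialize]
      rw [Finset.sum_eq_single_of_mem (m + 1) hN]
      · rw [pderiv_jet_succ]
        simp [jetSpecialize]
        ring
      · intro i hi hne'
        rw [pderiv_jet_of_le (by have := hmax i hi; omega), map_zero, mul_zero]
    have h1 : coeff (Finsupp.single 0 m) (pderiv m G) = algebraMap K M (c (m + 1)) * z 1 := by
      rw [hpd, coeff_C_mul, coeff_X_pow, if_pos rfl, mul_one]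
    rw [coeff_pderiv] at h1
    obtain ⟨a, ha⟩ := hrange (Finsupp.single 0 m + Finsupp.single m 1)
    rw [← ha] at h1
    refine hlift (z 1) (hcancel _ _ hcN ⟨a * ((Finsupp.single 0 m : ℕ →₀ ℕ) m + 1), ?_⟩)
    rw [← h1]
    simp

/-- The main step: `D` and `φ` satisfy a chain rule, the elements fixed by `φ` lie in `K`, and
`φ(Ψ) = r Ψ` has a differentially transcendental solution. Then a differentially algebraic
solution `f` of `φ(f) = f + b` or its derivative lies in `K`. -/
theorem mem_or_deriv_mem (φ : F →+* F) (D : Derivation ℤ F F)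
    (hφK : ∀ a : K, ∃ a' : K, φ (algebraMap K F a) = algebraMap K F a')
    (hDK : ∀ a : K, ∃ a' : K, D (algebraMap K F a) = algebraMap K F a')
    (hfix : ∀ x, φ x = x → x ∈ Set.range (algebraMap K F)) (r : K)
    (hchain : ∀ x, D (φ x) = algebraMap K F r * φ (D x)) {Ψ f : F} {b : K}
    (hΨ : φ Ψ = algebraMap K F r * Ψ) (hΨt : AlgebraicIndependent K fun i : ℕ => D^[i] Ψ)
    (hf : φ f = f + algebraMap K F b) (hfa : ¬ AlgebraicIndependent K fun i : ℕ => D^[i] f) :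
    f ∈ Set.range (algebraMap K F) ∨ D f ∈ Set.range (algebraMap K F) := by
  obtain ⟨M, hM, hDM, hfM⟩ := exists_fg_differential_field hDK hfa
  have hΨM := algebraicIndependent_of_fg hM hDM hΨt
  set y : ℕ → F := fun i => D^[i] Ψ with hy
  have hDy : ∀ i, D (y i) = y (i + 1) := fun i => (Function.iterate_succ_apply' D i Ψ).symm
  set L := adjoin K (Set.range y) with hL
  have hyL : ∀ i, y i ∈ L := fun i => subset_adjoin _ _ ⟨i, rfl⟩
  have hDL : ∀ x ∈ L, D x ∈ L := by
    intro x hx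
    refine deriv_mem_of_mem_adjoin ?_ ?_ ?_ hx
    · intro a
      obtain ⟨a', ha'⟩ := hDK a
      rw [ha']
      exact L.algebraMap_mem a'
    · rintro _ ⟨i, rfl⟩
      exact hyL i
    · rintro _ ⟨i, rfl⟩
      rw [hDy]
      exact hyL (i + 1)
  have hΨ0 : Ψ ≠ 0 := hΨt.ne_zero 0
  have hr0 : algebraMap K F r ≠ 0 := by
    intro h
    rw [h, zero_mul] at hΨ
    exact hΨ0 ((map_eq_zero φ).mp hΨ)
  have hφy : ∀ i, φ (y i) ∈ L := by
    intro i
    induction i with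
    | zero =>
      change φ Ψ ∈ L
      rw [hΨ]
      exact L.mul_mem (L.algebraMap_mem r) (hyL 0)
    | succ i ih =>
      have h := hchain (y i)
      rw [hDy] at h
      have h' : φ (y (i + 1)) = (algebraMap K F r)⁻¹ * D (φ (y i)) := by
        rw [h, inv_mul_cancel_left₀ hr0]
      rw [h']
      exact L.mul_mem (L.inv_mem (L.algebraMap_mem r)) (hDL _ ih)
  have hφL : ∀ x ∈ L, φ x ∈ L := by
    intro x hx
    induction hx using adjoin_induction with
    | mem x hx =>
      obtain ⟨i, rfl⟩ := hx
      exact hφy i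
    | algebraMap a =>
      obtain ⟨a', ha'⟩ := hφK a
      rw [ha']
      exact L.algebraMap_mem a'
    | add x y _ _ hx hy => rw [map_add]; exact L.add_mem hx hy
    | inv x _ hx => rw [map_inv₀]; exact L.inv_mem hx
    | mul x y _ _ hx hy => rw [map_mul]; exact L.mul_mem hx hy
  let σ : L →+* L := φ.restrict L L hφL
  let δ : F → F := fun z => Ψ * D z
  have hδφ : ∀ z, φ (δ z) = δ (φ z) := by
    intro z
    simp only [δ, map_mul, hΨ, hchain]
    ring
  have hδadd : ∀ z w, δ (z + w) = δ z + δ w := by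
    intro z w
    simp only [δ, map_add, mul_add]
  have hδL : ∀ x ∈ L, δ x ∈ L := fun x hx => L.mul_mem (hyL 0) (hDL x hx)
  let x : ℕ → F := fun i => δ^[i] f
  let β : ℕ → L := fun i => ⟨δ^[i] (algebraMap K F b), iterate_mem hδL (L.algebraMap_mem b) i⟩
  have hx : ∀ i, φ (x i) = x i + algebraMap L F (β i) := by
    intro i
    change φ (δ^[i] f) = δ^[i] f + δ^[i] (algebraMap K F b)
    induction i with
    | zero => exact hf
    | succ i ih =>
      simp only [Function.iterate_succ_apply']
      rw [hδφ, ih, hδadd]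
  have hdep : ¬ AlgebraicIndependent L x := by
    obtain ⟨S, hS⟩ := hM
    have hMS : ∀ m ∈ M, m ∈ adjoin L (S : Set F) := by
      intro m hm
      rw [← hS] at hm
      have : adjoin K (S : Set F) ≤ (adjoin L (S : Set F)).restrictScalars K :=
        adjoin_le_iff.mpr (subset_adjoin L (S : Set F))
      exact this hm
    have := finTrdeg_of_fg (fg_adjoin_of_finite (F := L) S.finite_toSet)
    refine not_algebraicIndependent_of_mem_finTrdeg (E := adjoin L (S : Set F)) fun i => ?_
    change δ^[i] f ∈ _
    rw [← aeval_jet]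
    generalize jet i = P
    induction P using MvPolynomial.induction_on with
    | C a => simp
    | add p q hp hq => rw [map_add]; exact add_mem hp hq
    | mul_X p j hp =>
      rw [map_mul, aeval_X]
      refine mul_mem hp ?_
      rcases j with k | k
      · exact hMS _ (iterate_mem hDM hfM k)
      · exact (adjoin L (S : Set F)).algebraMap_mem ⟨_, hyL k⟩
  obtain ⟨c, a, hc0, hcσ, hinv⟩ := exists_linear_invariant (σ := σ) (φ := φ)
    (fun _ => rfl) hx hdep
  have hcK : ∀ i, ∃ e : K, algebraMap K F e = (c i : F) := fun i =>
    hfix _ (congrArg Subtype.val (hcσ i))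
  choose e he using hcK
  obtain ⟨w, hw⟩ := hfix _ hinv
  have he0 : ∀ i, e i ≠ 0 ↔ c i ≠ 0 := by
    intro i
    rw [← map_ne_zero (algebraMap K F), he, Ne, Ne, ZeroMemClass.coe_eq_zero]
  let c' : ℕ →₀ K := Finsupp.onFinset c.support e fun i hi =>
    Finsupp.mem_support_iff.mpr ((he0 i).mp hi)
  have hc'supp : c'.support = c.support := by
    ext i
    rw [Finsupp.mem_support_iff, Finsupp.mem_support_iff]
    exact he0 i
  refine mem_or_deriv_mem_of_sum_mem hDM hfM hΨM (c := c') ?_ ?_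
  · rw [← Finsupp.support_nonempty_iff, hc'supp]
    exact Finsupp.support_nonempty_iff.mpr hc0
  · have hsum : (c'.sum fun i a => algebraMap K F a * (fun z => Ψ * D z)^[i] f) =
        c.sum fun i z => algebraMap L F z * x i := by
      rw [Finsupp.sum, Finsupp.sum, hc'supp]
      exact Finset.sum_congr rfl fun i _ => congrArg (· * x i) (he i)
    rw [hsum, ← add_sub_cancel_right (c.sum fun i z => algebraMap L F z * x i)
      (algebraMap L F a), ← hw]
    exact L.sub_mem (L.algebraMap_mem w) a.2

end Main

/-- Differential algebraicity is algebraic dependence of the sequence of derivatives. -/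
theorem diffAlgebraic_iff {K F : Type*} [Field K] [Field F] {ι : K →+* F} {D : F → F} {f : F} :
    DiffAlgebraic ι D f ↔ letI := ι.toAlgebra; ¬ AlgebraicIndependent K fun i : ℕ => D^[i] f := by
  let := ι.toAlgebra
  constructor
  · rintro ⟨n, P, hP0, hP⟩ h
    have h' : AlgebraicIndependent K fun i : Fin (n + 1) => D^[(i : ℕ)] f :=
      h.comp _ Fin.val_injective
    exact hP0 (h' (by rw [map_zero]; exact hP))
  · intro h
    rw [algebraicIndependent_iff_injective_aeval, injective_iff_map_eq_zero] at h
    push Not at h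
    obtain ⟨P, hP, hP0⟩ := h
    obtain ⟨s, Q, rfl⟩ := exists_finset_rename P
    let n := s.sup id
    let j : s → Fin (n + 1) := fun i => ⟨i, Nat.lt_succ_of_le (Finset.le_sup (f := id) i.2)⟩
    have hj : Function.Injective j := fun a b hab => Subtype.ext (congrArg Fin.val hab)
    refine ⟨n, rename j Q, ?_, ?_⟩
    · rintro h0
      apply hP0
      have : Q = 0 := rename_injective j hj (by rw [h0, map_zero])
      rw [this, map_zero]
    · rw [aeval_rename] at hP
      rw [eval₂_rename]
      exact hP

end

/-- An additive map of a field that satisfies the Leibniz rule, as a derivation. -/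
def derivationOf {F : Type*} [Field F] (d : F → F) (hadd : ∀ x y, d (x + y) = d x + d y)
    (hmul : ∀ x y, d (x * y) = x * d y + y * d x) : Derivation ℤ F F :=
  Derivation.mk' (AddMonoidHom.mk' d hadd).toIntLinearMap hmul

section ChainRule

variable {A F : Type*} [CommRing A] [Field F] [Algebra A F] [IsFractionRing A F]

/-- A chain rule for a derivation and an endomorphism of a fraction field need only be checked on
the ring. -/
theorem chain_rule_of_fraction {D : Derivation ℤ F F} {φ : F →+* F} {r : F}
    (h : ∀ a : A, D (φ (algebraMap A F a)) = r * φ (D (algebraMap A F a))) (x : F) :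
    D (φ x) = r * φ (D x) := by
  obtain ⟨a, b, hb, rfl⟩ := IsFractionRing.div_surjective (A := A) x
  rw [map_div₀, Derivation.leibniz_div, Derivation.leibniz_div, h, h]
  simp only [smul_eq_mul, map_sub, map_mul, map_inv₀, map_pow]
  ring

theorem exists_deriv_eq_of_fraction {E : Type*} [Field E] {ι : F →+* E} {D : Derivation ℤ E E}
    (h : ∀ a : A, ∃ q, D (ι (algebraMap A F a)) = ι q) (x : F) : ∃ q, D (ι x) = ι q := by
  obtain ⟨a, b, hb, rfl⟩ := IsFractionRing.div_surjective (A := A) x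
  obtain ⟨p, hp⟩ := h a
  obtain ⟨q, hq⟩ := h b
  refine ⟨(algebraMap A F b)⁻¹ ^ 2 * (algebraMap A F b * p - algebraMap A F a * q), ?_⟩
  rw [map_div₀, Derivation.leibniz_div, hp, hq]
  simp only [smul_eq_mul, map_mul, map_sub, map_inv₀, map_pow]

end ChainRule

section Laurent

open PowerSeries

theorem coeff_ddt (f : LaurentSeries ℂ) (n : ℤ) :
    (ddt f).coeff n = (n + 1) * f.coeff (n + 1) := by
  simp [ddt, LaurentSeries.derivative_apply, LaurentSeries.hasseDeriv_coeff]

theorem ddt_add (f g : LaurentSeries ℂ) : ddt (f + g) = ddt f + ddt g :=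
  map_add (LaurentSeries.derivative ℂ) f g

theorem ddt_toLaurent (g : PowerSeries ℂ) : ddt (toLaurent g) = toLaurent (d⁄dX ℂ g) := by
  ext n
  rw [coeff_ddt]
  change _ * (g : LaurentSeries ℂ).coeff _ = ((d⁄dX ℂ g : PowerSeries ℂ) : LaurentSeries ℂ).coeff _
  rw [PowerSeries.coeff_coe, PowerSeries.coeff_coe]
  rcases lt_trichotomy n (-1) with h | rfl | h
  · rw [if_pos (by omega), if_pos (by omega), mul_zero]
  · simp
  · rw [if_neg (by omega), if_neg (by omega), PowerSeries.coeff_derivative]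
    obtain ⟨k, rfl⟩ : ∃ k : ℕ, n = k := ⟨n.toNat, by omega⟩
    have : ((k : ℤ) + 1).natAbs = k + 1 := by omega
    rw [this]
    simp
    ring

theorem ddt_single_mul (m : ℤ) (f : LaurentSeries ℂ) :
    ddt (HahnSeries.single m 1 * f) =
      HahnSeries.single m 1 * ddt f + HahnSeries.single (m - 1) (m : ℂ) * f := by
  ext n
  rw [HahnSeries.coeff_add, coeff_ddt, HahnSeries.coeff_single_mul, HahnSeries.coeff_single_mul,
    HahnSeries.coeff_single_mul, coeff_ddt]
  have h1 : n - m + 1 = n + 1 - m := by ring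
  have h2 : n - (m - 1) = n + 1 - m := by ring
  rw [h1, h2]
  push_cast
  ring

theorem exists_eq_single_mul (f : LaurentSeries ℂ) :
    ∃ (m : ℤ) (p : PowerSeries ℂ), f = HahnSeries.single m 1 * toLaurent p :=
  ⟨f.order, f.powerSeriesPart, f.single_order_mul_powerSeriesPart.symm⟩

theorem ddt_mul (f g : LaurentSeries ℂ) : ddt (f * g) = f * ddt g + g * ddt f := by
  obtain ⟨m, p, rfl⟩ := exists_eq_single_mul f
  obtain ⟨n, q, rfl⟩ := exists_eq_single_mul g
  have h : HahnSeries.single m (1 : ℂ) * toLaurent p * (HahnSeries.single n 1 * toLaurent q) =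
      HahnSeries.single (m + n) 1 * toLaurent (p * q) := by
    rw [map_mul, show (1 : ℂ) = 1 * 1 by simp, ← HahnSeries.single_mul_single]
    simp only [mul_one]
    ring
  have hs : ∀ (a b : ℤ) (c : ℂ), HahnSeries.single a (1 : ℂ) * HahnSeries.single (b - 1) c =
      HahnSeries.single (a + b - 1) c := by
    intro a b c
    rw [HahnSeries.single_mul_single, one_mul, add_sub_assoc]
  rw [h, ddt_single_mul, ddt_single_mul, ddt_single_mul, ddt_toLaurent, ddt_toLaurent,
    ddt_toLaurent, Derivation.leibniz]
  have h1 : HahnSeries.single (m + n) (1 : ℂ) =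
      HahnSeries.single m (1 : ℂ) * HahnSeries.single n (1 : ℂ) := by
    rw [HahnSeries.single_mul_single, one_mul]
  have h2 : HahnSeries.single (m + n - 1) (((m + n : ℤ)) : ℂ) =
      HahnSeries.single m (1 : ℂ) * HahnSeries.single (n - 1) (n : ℂ) +
      HahnSeries.single n (1 : ℂ) * HahnSeries.single (m - 1) (m : ℂ) := by
    rw [hs, hs, add_comm n m, ← HahnSeries.single_add]
    congr 1
    push_cast
    ring
  rw [h1, h2]
  simp only [smul_eq_mul, map_add, map_mul]
  ring

/-- `d/dt` as a derivation of `ℂ((t))`. -/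
def ddtDer := derivationOf ddt ddt_add ddt_mul

@[simp]
theorem ddtDer_apply (f : LaurentSeries ℂ) : ddtDer f = ddt f := rfl

theorem ddt_C (c : ℂ) : ddt (HahnSeries.C c) = 0 := by
  ext n
  rw [coeff_ddt, HahnSeries.coeff_zero]
  by_cases h : n + 1 = 0
  · have : (n : ℂ) + 1 = 0 := by exact_mod_cast h
    rw [this, zero_mul]
  · rw [HahnSeries.C_apply, HahnSeries.coeff_single_of_ne h, mul_zero]

theorem eq_C_of_ddt_eq_zero {f : LaurentSeries ℂ} (h : ddt f = 0) :
    f = HahnSeries.C (f.coeff 0) := by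
  ext n
  by_cases hn : n = 0
  · subst hn
    simp [HahnSeries.C_apply]
  · rw [HahnSeries.C_apply, HahnSeries.coeff_single_of_ne hn]
    have h1 := coeff_ddt f (n - 1)
    rw [h, HahnSeries.coeff_zero] at h1
    push_cast at h1
    rw [sub_add_cancel, sub_add_cancel] at h1
    exact (mul_eq_zero.mp h1.symm).resolve_left (by exact_mod_cast hn)

variable {R : PowerSeries ℂ} {h0 : constantCoeff R = 0} {hne : R ≠ 0}

theorem Phi_toLaurent (g : PowerSeries ℂ) : Phi R h0 hne (toLaurent g) = toLaurent (g.subst R) := by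
  rw [← compPower_apply R h0]
  exact IsLocalization.Away.lift_eq (S := LaurentSeries ℂ) (PowerSeries.X : PowerSeries ℂ)
    (isUnit_compPower_X R h0 hne) g

theorem Phi_C (c : ℂ) : Phi R h0 hne (HahnSeries.C c) = HahnSeries.C c := by
  rw [← PowerSeries.coe_C]
  change Phi R h0 hne (toLaurent _) = toLaurent _
  rw [Phi_toLaurent, PowerSeries.subst_C]
  rfl

theorem ddt_Phi (f : LaurentSeries ℂ) :
    ddt (Phi R h0 hne f) = ddt (toLaurent R) * Phi R h0 hne (ddt f) := by
  refine chain_rule_of_fraction (A := PowerSeries ℂ) (D := ddtDer) (fun g => ?_) f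
  change ddt (Phi R h0 hne (toLaurent g)) = ddt (toLaurent R) * Phi R h0 hne (ddt (toLaurent g))
  rw [Phi_toLaurent, ddt_toLaurent, ddt_toLaurent, ddt_toLaurent, Phi_toLaurent, ← map_mul,
    PowerSeries.derivative_subst (PowerSeries.HasSubst.of_constantCoeff_zero' h0), mul_comm]

theorem ratToLaurent_algebraMap (p : Polynomial ℂ) :
    ratToLaurent (algebraMap (Polynomial ℂ) (RatFunc ℂ) p) = toLaurent (p : PowerSeries ℂ) :=
  (RatFunc.coe_coe p).symm

theorem ratToLaurent_C (c : ℂ) : ratToLaurent (RatFunc.C c) = HahnSeries.C c := by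
  rw [← RatFunc.algebraMap_C, ratToLaurent_algebraMap, Polynomial.coe_C]
  exact PowerSeries.coe_C c

theorem exists_ratToLaurent_Phi (hrat : IsRational (toLaurent R)) (q : RatFunc ℂ) :
    ∃ q', Phi R h0 hne (ratToLaurent q) = ratToLaurent q' := by
  obtain ⟨ρ, hρ⟩ := hrat
  have hpoly : ∀ p : Polynomial ℂ, Phi R h0 hne (ratToLaurent (algebraMap _ _ p)) =
      ratToLaurent (p.eval₂ RatFunc.C ρ) := by
    intro p
    induction p using Polynomial.induction_on' with
    | add p q hp hq => simp only [map_add, hp, hq, Polynomial.eval₂_add]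
    | monomial n a =>
      rw [Polynomial.eval₂_monomial, ← Polynomial.C_mul_X_pow_eq_monomial, map_mul, map_mul,
        map_mul, map_mul, map_pow, map_pow, map_pow, map_pow, hρ, RatFunc.algebraMap_C,
        ratToLaurent_C, Phi_C, ratToLaurent_algebraMap, Polynomial.coe_X, Phi_toLaurent,
        PowerSeries.subst_X (PowerSeries.HasSubst.of_constantCoeff_zero' h0)]
  obtain ⟨a, b, hb, rfl⟩ := IsFractionRing.div_surjective (A := Polynomial ℂ) q
  exact ⟨a.eval₂ RatFunc.C ρ / b.eval₂ RatFunc.C ρ, by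
    rw [map_div₀, map_div₀, map_div₀, hpoly, hpoly]⟩

theorem exists_ratToLaurent_ddt (q : RatFunc ℂ) :
    ∃ q', ddt (ratToLaurent q) = ratToLaurent q' := by
  refine exists_deriv_eq_of_fraction (A := Polynomial ℂ) (D := ddtDer) (fun p => ?_) q
  exact ⟨algebraMap _ _ p.derivative, by
    rw [ddtDer_apply, ratToLaurent_algebraMap, ddt_toLaurent, PowerSeries.derivative_coe,
      ratToLaurent_algebraMap]⟩

end Laurent

section FixedElements

open PowerSeries

theorem exists_eq_X_mul {S : PowerSeries ℂ} (h0 : constantCoeff S = 0) :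
    ∃ U, S = X * U ∧ constantCoeff U = coeff 1 S := by
  obtain ⟨U, rfl⟩ := X_dvd_iff.mpr h0
  refine ⟨U, rfl, ?_⟩
  rw [← coeff_zero_eq_constantCoeff_apply, ← coeff_succ_X_mul 0 U]

theorem coeff_subst_of_forall_lt {R h : PowerSeries ℂ} (h0 : constantCoeff R = 0) {m : ℕ}
    (hm : ∀ i < m, coeff i h = 0) :
    coeff m (h.subst R) = coeff m h * coeff 1 R ^ m := by
  obtain ⟨U, hU, hU1⟩ := exists_eq_X_mul h0
  rw [coeff_subst' (HasSubst.of_constantCoeff_zero' h0), finsum_eq_single _ m, smul_eq_mul, hU,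
    mul_pow, ← hU, ← hU1, coeff_X_pow_mul', if_pos le_rfl, Nat.sub_self,
    coeff_zero_eq_constantCoeff_apply, map_pow]
  intro d hd
  rcases lt_or_gt_of_ne hd with h' | h'
  · rw [hm d h', zero_smul]
  · rw [hU, mul_pow, coeff_X_pow_mul', if_neg (by omega), smul_zero]

theorem constantCoeff_iter {R : PowerSeries ℂ} (h0 : constantCoeff R = 0) (n : ℕ) :
    constantCoeff (iter R n) = 0 := by
  cases n with
  | zero => simp [iter]
  | succ n =>
    rw [iter, Function.iterate_succ_apply']
    have ih := constantCoeff_iter h0 n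
    rw [← coeff_zero_eq_constantCoeff_apply, coeff_subst_of_forall_lt h0 (by simp), pow_zero,
      mul_one, coeff_zero_eq_constantCoeff_apply]
    exact ih

theorem coeff_one_iter {R : PowerSeries ℂ} (h0 : constantCoeff R = 0) (n : ℕ) :
    coeff 1 (iter R n) = coeff 1 R ^ n := by
  induction n with
  | zero => simp [iter]
  | succ n ih =>
    have h := constantCoeff_iter h0 n
    rw [iter, Function.iterate_succ_apply', coeff_subst_of_forall_lt h0, pow_one, pow_succ, ← ih,
      iter]
    intro i hi
    obtain rfl : i = 0 := by omega
    rw [coeff_zero_eq_constantCoeff_apply]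
    exact h

theorem subst_iter {R h : PowerSeries ℂ} (h0 : constantCoeff R = 0) (hh : h.subst R = h) (n : ℕ) :
    h.subst (iter R n) = h := by
  induction n with
  | zero => exact X_subst h
  | succ n ih =>
    have hn := constantCoeff_iter h0 n
    rw [iter, Function.iterate_succ_apply', ← iter]
    rw [← subst_comp_subst_apply (HasSubst.of_constantCoeff_zero' hn)
      (HasSubst.of_constantCoeff_zero' h0), ih, hh]

/-- A nonzero power series without constant term is not invariant under `S ≠ X` with `S'(0) = 1`. -/
theorem subst_ne_of_coeff_one_eq_one {S h : PowerSeries ℂ} (h0 : constantCoeff S = 0)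
    (h1 : coeff 1 S = 1) (hS : S ≠ X) {m : ℕ} (hm0 : m ≠ 0) (hm : coeff m h ≠ 0)
    (hlt : ∀ i < m, coeff i h = 0) : h.subst S ≠ h := by
  intro hh
  obtain ⟨U, hU, hU1⟩ := exists_eq_X_mul h0
  have hSX : S - X ≠ 0 := sub_ne_zero.mpr hS
  set k := (S - X).order.toNat with hk
  obtain ⟨V, hV⟩ : X ^ k ∣ S - X := X_pow_order_dvd
  have hV0 : constantCoeff V ≠ 0 := by
    have hc : coeff k (S - X) ≠ 0 := coeff_order hSX
    rwa [hV, coeff_X_pow_mul', if_pos le_rfl, Nat.sub_self,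
      coeff_zero_eq_constantCoeff_apply] at hc
  have hdiff : ∀ d : ℕ, d ≠ 0 → S ^ d - X ^ d =
      X ^ (d - 1 + k) * ((∑ i ∈ Finset.range d, U ^ i) * V) := by
    intro d hd
    rw [← geom_sum₂_mul, hV]
    have : ∑ i ∈ Finset.range d, S ^ i * X ^ (d - 1 - i) =
        X ^ (d - 1) * ∑ i ∈ Finset.range d, U ^ i := by
      rw [Finset.mul_sum]
      refine Finset.sum_congr rfl fun i hi => ?_
      have hi' : d - 1 = i + (d - 1 - i) := by
        have := Finset.mem_range.mp hi
        omega
      conv_rhs => rw [hi', pow_add]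
      rw [hU, mul_pow]
      ring
    rw [this, pow_add]
    ring
  have hsub := HasSubst.of_constantCoeff_zero' h0
  have e1 := coeff_subst' hsub h (m - 1 + k)
  have e2 := coeff_subst' (HasSubst.X' (R := ℂ)) h (m - 1 + k)
  rw [X_subst] at e2
  rw [hh, e2] at e1
  have e3 : ∑ᶠ d, (coeff d h • coeff (m - 1 + k) (S ^ d) -
      coeff d h • coeff (m - 1 + k) (X ^ d)) = 0 := by
    rw [finsum_sub_distrib (coeff_subst_finite' hsub h _) (coeff_subst_finite' HasSubst.X' h _),
      e1, sub_self]
  rw [finsum_eq_single _ m] at e3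
  · rw [← smul_sub, ← map_sub, hdiff m hm0, coeff_X_pow_mul', if_pos le_rfl, Nat.sub_self,
      coeff_zero_eq_constantCoeff_apply, map_mul, map_sum] at e3
    simp only [map_pow, hU1, h1, one_pow, Finset.sum_const, Finset.card_range, nsmul_eq_mul,
      mul_one, smul_eq_mul] at e3
    exact mul_ne_zero hm (mul_ne_zero (Nat.cast_ne_zero.mpr hm0) hV0) e3
  · intro d hd
    rw [← smul_sub, ← map_sub]
    rcases lt_or_gt_of_ne hd with h' | h'
    · rw [hlt d h', zero_smul]
    · rw [hdiff d (by omega), coeff_X_pow_mul', if_neg (by omega), smul_zero]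

variable {R : PowerSeries ℂ} {h0 : constantCoeff R = 0} {hne : R ≠ 0}

theorem coeff_order_ne_zero {x : LaurentSeries ℂ} (hx : x ≠ 0) : x.coeff x.order ≠ 0 :=
  fun h => hx (HahnSeries.coeff_order_eq_zero.mp h)

theorem order_inv {x : LaurentSeries ℂ} (hx : x ≠ 0) : (x⁻¹).order = -x.order := by
  have h := HahnSeries.order_mul hx (inv_ne_zero hx)
  rw [mul_inv_cancel₀ hx, HahnSeries.order_one] at h
  omega

theorem exists_powerSeries_of_order_pos {x : LaurentSeries ℂ} (hx : x ≠ 0) (hpos : 0 < x.order) :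
    ∃ (h : PowerSeries ℂ) (m : ℕ), toLaurent h = x ∧ m ≠ 0 ∧ coeff m h ≠ 0 ∧
      ∀ i < m, coeff i h = 0 := by
  obtain ⟨m, hm⟩ : ∃ m : ℕ, x.order = m := ⟨x.order.toNat, by omega⟩
  have hx' := LaurentSeries.X_order_mul_powerSeriesPart hm.symm
  refine ⟨X ^ m * x.powerSeriesPart, m, hx', by omega, ?_, ?_⟩
  · rw [coeff_X_pow_mul', if_pos le_rfl, Nat.sub_self, LaurentSeries.powerSeriesPart_coeff]
    simpa using coeff_order_ne_zero hx
  · intro i hi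
    rw [coeff_X_pow_mul', if_neg (by omega)]

theorem eq_pow_of_Phi_eq_of_order_pos {x : LaurentSeries ℂ} {c : ℂ} (hx : x ≠ 0)
    (hpos : 0 < x.order) (hΦ : Phi R h0 hne x = HahnSeries.C c * x) :
    ∃ m : ℕ, m ≠ 0 ∧ c = coeff 1 R ^ m := by
  obtain ⟨h, m, rfl, hm0, hm, hlt⟩ := exists_powerSeries_of_order_pos hx hpos
  refine ⟨m, hm0, ?_⟩
  rw [Phi_toLaurent, ← PowerSeries.coe_C] at hΦ
  change toLaurent _ = toLaurent _ * toLaurent _ at hΦ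
  rw [← map_mul] at hΦ
  have h1 := congrArg (coeff m) (HahnSeries.ofPowerSeries_injective hΦ)
  rw [coeff_subst_of_forall_lt h0 hlt, coeff_C_mul, mul_comm] at h1
  exact (mul_right_cancel₀ hm h1).symm

theorem not_Phi_eq_of_order_pos (hiter : ∀ n : ℕ, 1 ≤ n → iter R n ≠ X) {x : LaurentSeries ℂ}
    (hx : x ≠ 0) (hpos : 0 < x.order) : Phi R h0 hne x ≠ x := by
  intro hΦ
  obtain ⟨h, m, rfl, hm0, hm, hlt⟩ := exists_powerSeries_of_order_pos hx hpos
  rw [Phi_toLaurent] at hΦ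
  have hh := HahnSeries.ofPowerSeries_injective hΦ
  have h1 := coeff_subst_of_forall_lt h0 hlt
  rw [hh] at h1
  have hq : coeff 1 R ^ m = 1 := by
    have h2 : coeff m h * coeff 1 R ^ m = coeff m h * 1 := by rw [← h1, mul_one]
    exact mul_left_cancel₀ hm h2
  exact subst_ne_of_coeff_one_eq_one (constantCoeff_iter h0 m) ((coeff_one_iter h0 m).trans hq)
    (hiter m (by omega)) hm0 hm hlt (subst_iter h0 hh m)

/-- The elements of `ℂ((t))` fixed by `Φ_R` are constant. -/
theorem eq_C_of_Phi_eq_self (hiter : ∀ n : ℕ, 1 ≤ n → iter R n ≠ X) {x : LaurentSeries ℂ}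
    (hx : Phi R h0 hne x = x) : x = HahnSeries.C (x.coeff 0) := by
  rw [← sub_eq_zero]
  set z := x - HahnSeries.C (x.coeff 0) with hz
  have hΦz : Phi R h0 hne z = z := by rw [hz, map_sub, hx, Phi_C]
  by_contra hz0
  have hzc : z.coeff 0 = 0 := by simp [hz, HahnSeries.C_apply]
  have hord : z.order ≠ 0 := by
    intro h
    have h1 := coeff_order_ne_zero hz0
    rw [h] at h1
    exact h1 hzc
  rcases lt_or_gt_of_ne hord with h | h
  · refine not_Phi_eq_of_order_pos (h0 := h0) (hne := hne) hiter (inv_ne_zero hz0) ?_ ?_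
    · rw [order_inv hz0]
      omega
    · rw [map_inv₀, hΦz]
  · exact not_Phi_eq_of_order_pos hiter hz0 h hΦz

theorem eq_one_of_Phi_eq_of_order_eq_zero {x : LaurentSeries ℂ} {c : ℂ} (hx0 : x ≠ 0)
    (hord : x.order = 0) (hx : Phi R h0 hne x = HahnSeries.C c * x) : c = 1 := by
  obtain ⟨g, hg⟩ : ∃ g : PowerSeries ℂ, toLaurent g = x :=
    ⟨_, by simpa using LaurentSeries.X_order_mul_powerSeriesPart (n := 0) hord.symm⟩
  have hg0 : coeff 0 g ≠ 0 := by
    have := coeff_order_ne_zero hx0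
    rw [hord, ← hg] at this
    change (g : LaurentSeries ℂ).coeff _ ≠ 0 at this
    rw [PowerSeries.coeff_coe] at this
    simpa using this
  rw [← hg, Phi_toLaurent, ← PowerSeries.coe_C] at hx
  change toLaurent _ = toLaurent _ * toLaurent _ at hx
  rw [← map_mul] at hx
  have h2 := congrArg (coeff 0) (HahnSeries.ofPowerSeries_injective hx)
  rw [coeff_subst_of_forall_lt h0 (by simp), coeff_C_mul, pow_zero, mul_comm] at h2
  exact (mul_right_cancel₀ hg0 h2).symm

/-- If `R'(0) = 0`, then `Φ_R` has no eigenvalue in `ℂ` other than `1`, and the eigenvectors are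
the constants. -/
theorem eq_C_of_Phi_eq_C_mul (h1 : coeff 1 R = 0) {x : LaurentSeries ℂ} {c : ℂ} (hx0 : x ≠ 0)
    (hc : c ≠ 0) (hx : Phi R h0 hne x = HahnSeries.C c * x) :
    c = 1 ∧ x = HahnSeries.C (x.coeff 0) := by
  have key : ∀ (y : LaurentSeries ℂ) (e : ℂ), y ≠ 0 → e ≠ 0 →
      Phi R h0 hne y = HahnSeries.C e * y → ¬ 0 < y.order := by
    intro y e hy he hΦ hpos
    obtain ⟨m, hm, hem⟩ := eq_pow_of_Phi_eq_of_order_pos hy hpos hΦ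
    rw [h1, zero_pow hm] at hem
    exact he hem
  have hord : x.order = 0 := by
    by_contra hord
    rcases lt_or_gt_of_ne hord with h | h
    · refine key x⁻¹ c⁻¹ (inv_ne_zero hx0) (inv_ne_zero hc) ?_ ?_
      · rw [map_inv₀, hx, mul_inv, map_inv₀]
      · rw [order_inv hx0]
        omega
    · exact key x c hx0 hc hx h
  have hc1 : c = 1 := eq_one_of_Phi_eq_of_order_eq_zero hx0 hord hx
  refine ⟨hc1, ?_⟩
  rw [hc1, map_one, one_mul] at hx
  have hiter : ∀ n : ℕ, 1 ≤ n → iter R n ≠ X := by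
    intro n hn hX
    have h2 := coeff_one_iter h0 n
    rw [hX, h1, zero_pow (by omega), coeff_one_X] at h2
    exact one_ne_zero h2
  exact eq_C_of_Phi_eq_self hiter hx

end FixedElements

section AdjoinDerivation

variable {K : Type*} [Field K]

theorem coeff_polyDeriv {δ : K → K} (hδ0 : δ 0 = 0) (s : K) (p : Polynomial K) (n : ℕ) :
    (polyDeriv δ s p).coeff n = δ (p.coeff n) + s * (p.coeff (n + 1) * (n + 1)) := by
  rw [polyDeriv, Polynomial.coeff_add, Polynomial.coeff_C_mul, Polynomial.coeff_derivative,
    Polynomial.sum, Polynomial.finsetSum_coeff]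
  simp only [Polynomial.coeff_monomial, Finset.sum_ite_eq']
  split_ifs with h
  · rfl
  · rw [Polynomial.notMem_support_iff.mp h, hδ0]

theorem polyDeriv_add {δ : K → K} (hadd : ∀ x y, δ (x + y) = δ x + δ y) (s : K)
    (p q : Polynomial K) :
    polyDeriv δ s (p + q) = polyDeriv δ s p + polyDeriv δ s q := by
  have hδ0 : δ 0 = 0 := by simpa using hadd 0 0
  ext n
  simp only [Polynomial.coeff_add, coeff_polyDeriv hδ0, hadd]
  ring

theorem polyDeriv_mul {δ : K → K} (hadd : ∀ x y, δ (x + y) = δ x + δ y)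
    (hmul : ∀ x y, δ (x * y) = x * δ y + y * δ x) (s : K) (p q : Polynomial K) :
    polyDeriv δ s (p * q) = p * polyDeriv δ s q + q * polyDeriv δ s p := by
  have hδ0 : δ 0 = 0 := by simpa using hadd 0 0
  have hsplit : ∀ p : Polynomial K,
      polyDeriv δ s p = polyDeriv δ 0 p + Polynomial.C s * p.derivative := by
    intro p
    simp [polyDeriv]
  have hzero : polyDeriv δ 0 (p * q) = p * polyDeriv δ 0 q + q * polyDeriv δ 0 p := by
    ext n
    rw [mul_comm q]
    simp only [Polynomial.coeff_add, coeff_polyDeriv hδ0, zero_mul, add_zero, Polynomial.coeff_mul]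
    rw [← Finset.sum_add_distrib]
    have hsum : ∀ (t : Finset (ℕ × ℕ)) (g : ℕ × ℕ → K), δ (∑ x ∈ t, g x) = ∑ x ∈ t, δ (g x) :=
      fun t g => map_sum (AddMonoidHom.mk' δ hadd) g t
    rw [hsum]
    refine Finset.sum_congr rfl fun x _ => ?_
    rw [hmul]
    ring
  rw [hsplit, hsplit q, hsplit p, hzero, Polynomial.derivative_mul]
  ring

theorem ratDeriv_div {δ : K → K} (hadd : ∀ x y, δ (x + y) = δ x + δ y)
    (hmul : ∀ x y, δ (x * y) = x * δ y + y * δ x) (s : K) (a b : Polynomial K) (hb : b ≠ 0) :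
    ratDeriv δ s (algebraMap _ (RatFunc K) a / algebraMap _ (RatFunc K) b) =
      (algebraMap _ (RatFunc K) (polyDeriv δ s a) * algebraMap _ (RatFunc K) b -
        algebraMap _ (RatFunc K) a * algebraMap _ (RatFunc K) (polyDeriv δ s b)) /
          algebraMap _ (RatFunc K) b ^ 2 := by
  set F := algebraMap _ (RatFunc K) a / algebraMap _ (RatFunc K) b with hF
  have hbF : algebraMap _ (RatFunc K) b ≠ 0 := RatFunc.algebraMap_ne_zero hb
  have hdF : algebraMap _ (RatFunc K) F.denom ≠ 0 := RatFunc.algebraMap_ne_zero F.denom_ne_zero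
  have h1 : F.num * b = a * F.denom := by
    apply RatFunc.algebraMap_injective K
    rw [map_mul, map_mul, ← div_eq_div_iff hdF hbF, RatFunc.num_div_denom]
  have h2 := congrArg (fun p => algebraMap _ (RatFunc K) (polyDeriv δ s p)) h1
  simp only [polyDeriv_mul hadd hmul, map_add, map_mul] at h2
  have h3 := congrArg (algebraMap _ (RatFunc K)) h1
  rw [map_mul, map_mul] at h3
  rw [ratDeriv, div_eq_div_iff (pow_ne_zero 2 hdF) (pow_ne_zero 2 hbF)]
  linear_combination algebraMap _ (RatFunc K) b * algebraMap _ (RatFunc K) F.denom * h2 -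
    (algebraMap _ (RatFunc K) (polyDeriv δ s F.denom) * algebraMap _ (RatFunc K) b +
      algebraMap _ (RatFunc K) F.denom * algebraMap _ (RatFunc K) (polyDeriv δ s b)) * h3

theorem ratDeriv_add {δ : K → K} (hadd : ∀ x y, δ (x + y) = δ x + δ y)
    (hmul : ∀ x y, δ (x * y) = x * δ y + y * δ x) (s : K) (x y : RatFunc K) :
    ratDeriv δ s (x + y) = ratDeriv δ s x + ratDeriv δ s y := by
  obtain ⟨a, b, hb, rfl⟩ := IsFractionRing.div_surjective (A := Polynomial K) x
  obtain ⟨c, d, hd, rfl⟩ := IsFractionRing.div_surjective (A := Polynomial K) y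
  have hb' := nonZeroDivisors.ne_zero hb
  have hd' := nonZeroDivisors.ne_zero hd
  have hbF : algebraMap _ (RatFunc K) b ≠ 0 := RatFunc.algebraMap_ne_zero hb'
  have hdF : algebraMap _ (RatFunc K) d ≠ 0 := RatFunc.algebraMap_ne_zero hd'
  rw [div_add_div _ _ hbF hdF, ← map_mul, ← map_mul, ← map_mul, ← map_add,
    ratDeriv_div hadd hmul s _ _ (mul_ne_zero hb' hd'), ratDeriv_div hadd hmul s _ _ hb',
    ratDeriv_div hadd hmul s _ _ hd', polyDeriv_add hadd, polyDeriv_mul hadd hmul,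
    polyDeriv_mul hadd hmul, polyDeriv_mul hadd hmul]
  simp only [map_add, map_mul]
  field_simp
  ring

theorem ratDeriv_mul {δ : K → K} (hadd : ∀ x y, δ (x + y) = δ x + δ y)
    (hmul : ∀ x y, δ (x * y) = x * δ y + y * δ x) (s : K) (x y : RatFunc K) :
    ratDeriv δ s (x * y) = x * ratDeriv δ s y + y * ratDeriv δ s x := by
  obtain ⟨a, b, hb, rfl⟩ := IsFractionRing.div_surjective (A := Polynomial K) x
  obtain ⟨c, d, hd, rfl⟩ := IsFractionRing.div_surjective (A := Polynomial K) y
  have hb' := nonZeroDivisors.ne_zero hb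
  have hd' := nonZeroDivisors.ne_zero hd
  have hbF : algebraMap _ (RatFunc K) b ≠ 0 := RatFunc.algebraMap_ne_zero hb'
  have hdF : algebraMap _ (RatFunc K) d ≠ 0 := RatFunc.algebraMap_ne_zero hd'
  rw [div_mul_div_comm, ← map_mul, ← map_mul,
    ratDeriv_div hadd hmul s _ _ (mul_ne_zero hb' hd'), ratDeriv_div hadd hmul s _ _ hb',
    ratDeriv_div hadd hmul s _ _ hd', polyDeriv_mul hadd hmul, polyDeriv_mul hadd hmul]
  simp only [map_add, map_mul]
  field_simp
  ring

theorem ratDeriv_algebraMap {δ : K → K} (hadd : ∀ x y, δ (x + y) = δ x + δ y)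
    (hmul : ∀ x y, δ (x * y) = x * δ y + y * δ x) (s : K) (p : Polynomial K) :
    ratDeriv δ s (algebraMap _ (RatFunc K) p) = algebraMap _ (RatFunc K) (polyDeriv δ s p) := by
  have hδ1 : δ 1 = 0 := by simpa using hmul 1 1
  have h := ratDeriv_div hadd hmul s p 1 one_ne_zero
  have h1 : polyDeriv δ s 1 = 0 := by
    have hδ0 : δ 0 = 0 := by simpa using hadd 0 0
    ext n
    rw [coeff_polyDeriv hδ0, Polynomial.coeff_one, Polynomial.coeff_one]
    split_ifs <;> simp_all
  simpa [h1] using h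

theorem ratDeriv_C {δ : K → K} (hadd : ∀ x y, δ (x + y) = δ x + δ y)
    (hmul : ∀ x y, δ (x * y) = x * δ y + y * δ x) (s a : K) :
    ratDeriv δ s (RatFunc.C a) = RatFunc.C (δ a) := by
  have hδ0 : δ 0 = 0 := by simpa using hadd 0 0
  rw [← RatFunc.algebraMap_C, ratDeriv_algebraMap hadd hmul, ← RatFunc.algebraMap_C]
  congr 1
  ext n
  rw [coeff_polyDeriv hδ0, Polynomial.coeff_C, Polynomial.coeff_C, Polynomial.coeff_C]
  split_ifs <;> simp_all

theorem ratDeriv_X {δ : K → K} (hadd : ∀ x y, δ (x + y) = δ x + δ y)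
    (hmul : ∀ x y, δ (x * y) = x * δ y + y * δ x) (s : K) :
    ratDeriv δ s RatFunc.X = RatFunc.C s := by
  have hδ0 : δ 0 = 0 := by simpa using hadd 0 0
  have hδ1 : δ 1 = 0 := by simpa using hmul 1 1
  rw [← RatFunc.algebraMap_X, ratDeriv_algebraMap hadd hmul, ← RatFunc.algebraMap_C]
  congr 1
  rw [polyDeriv, Polynomial.derivative_X, mul_one, Polynomial.sum_X_index (by simp [hδ0]), hδ1,
    Polynomial.monomial_zero_right, zero_add]

theorem ratEndo_algebraMap (φ : K →+* K) {α : K} (hα : α ≠ 0) (β : K) (p : Polynomial K) :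
    ratEndo φ α hα β (algebraMap _ (RatFunc K) p) =
      algebraMap _ (RatFunc K) (polyEndo φ α β p) := by
  have h := RatFunc.map_apply_div (polyEndo φ α β)
    (nonZeroDivisors_le_comap_nonZeroDivisors_of_injective _ (polyEndo_injective φ hα β)) p 1
  simp only [map_one, div_one] at h
  exact h

theorem ratEndo_C (φ : K →+* K) {α : K} (hα : α ≠ 0) (β a : K) :
    ratEndo φ α hα β (RatFunc.C a) = RatFunc.C (φ a) := by
  rw [← RatFunc.algebraMap_C, ratEndo_algebraMap, ← RatFunc.algebraMap_C]
  simp [polyEndo]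

theorem ratEndo_X (φ : K →+* K) {α : K} (hα : α ≠ 0) (β : K) :
    ratEndo φ α hα β RatFunc.X = RatFunc.C α * RatFunc.X + RatFunc.C β := by
  rw [← RatFunc.algebraMap_X, ratEndo_algebraMap]
  simp [polyEndo]

theorem polyEndo_eq_comp (φ : K →+* K) (α β : K) (p : Polynomial K) :
    polyEndo φ α β p =
      (p.map φ).comp (Polynomial.C α * Polynomial.X + Polynomial.C β) := by
  simp [polyEndo, Polynomial.comp, Polynomial.eval₂_map]

theorem natDegree_polyEndo (φ : K →+* K) {α : K} (hα : α ≠ 0) (β : K) (p : Polynomial K) :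
    (polyEndo φ α β p).natDegree = p.natDegree := by
  rw [polyEndo_eq_comp, Polynomial.natDegree_comp, Polynomial.natDegree_linear hα, mul_one,
    Polynomial.natDegree_map]

theorem leadingCoeff_polyEndo (φ : K →+* K) {α : K} (hα : α ≠ 0) (β : K) (p : Polynomial K) :
    (polyEndo φ α β p).leadingCoeff = φ p.leadingCoeff * α ^ p.natDegree := by
  rw [polyEndo_eq_comp, Polynomial.leadingCoeff_comp (by rw [Polynomial.natDegree_linear hα]; simp),
    Polynomial.leadingCoeff_linear hα, Polynomial.natDegree_map, Polynomial.leadingCoeff_map]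

/-- The numerator and the denominator of an invariant fraction are eigenvectors. -/
theorem polyEndo_num_denom_of_ratEndo_eq_self (φ : K →+* K) {α : K} (hα : α ≠ 0) (β : K)
    {x : RatFunc K} (hx : ratEndo φ α hα β x = x) :
    polyEndo φ α β x.denom = Polynomial.C (α ^ x.denom.natDegree) * x.denom ∧
      polyEndo φ α β x.num = Polynomial.C (α ^ x.denom.natDegree) * x.num := by
  have hd0 : x.denom ≠ 0 := x.denom_ne_zero
  have hE0 : polyEndo φ α β x.denom ≠ 0 :=
    (map_ne_zero_iff _ (polyEndo_injective φ hα β)).mpr hd0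
  have hcross : polyEndo φ α β x.num * x.denom = x.num * polyEndo φ α β x.denom := by
    apply RatFunc.algebraMap_injective K
    rw [map_mul, map_mul, ← div_eq_div_iff (RatFunc.algebraMap_ne_zero hE0)
      (RatFunc.algebraMap_ne_zero hd0), RatFunc.num_div_denom, ← ratEndo_algebraMap φ hα,
      ← ratEndo_algebraMap φ hα, ← map_div₀, RatFunc.num_div_denom, hx]
  have hcop : IsCoprime (polyEndo φ α β x.denom) (polyEndo φ α β x.num) :=
    (RatFunc.isCoprime_num_denom x).symm.map _
  obtain ⟨u, hu⟩ : polyEndo φ α β x.denom ∣ x.denom :=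
    hcop.dvd_of_dvd_mul_left (hcross ▸ Dvd.intro_left _ rfl)
  have hu0 : u ≠ 0 := by
    rintro rfl
    rw [mul_zero] at hu
    exact hd0 hu
  have hdeg := congrArg Polynomial.natDegree hu
  rw [Polynomial.natDegree_mul hE0 hu0, natDegree_polyEndo φ hα] at hdeg
  obtain ⟨c, rfl⟩ : ∃ c, u = Polynomial.C c :=
    ⟨_, Polynomial.eq_C_of_natDegree_eq_zero (by omega)⟩
  have hlc := congrArg Polynomial.leadingCoeff hu
  rw [Polynomial.leadingCoeff_mul, leadingCoeff_polyEndo φ hα, Polynomial.leadingCoeff_C,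
    (RatFunc.monic_denom x).leadingCoeff, map_one, one_mul] at hlc
  have hden : polyEndo φ α β x.denom = Polynomial.C (α ^ x.denom.natDegree) * x.denom := by
    conv_rhs => rw [hu]
    rw [mul_left_comm, ← Polynomial.C_mul]
    have : α ^ (polyEndo φ α β x.denom * Polynomial.C c).natDegree * c = 1 := by
      rw [← hu, ← hlc]
    rw [this, Polynomial.C_1, mul_one]
  refine ⟨hden, mul_right_cancel₀ hd0 ?_⟩
  rw [hcross, hden]
  ring

end AdjoinDerivation

section LogField

open PowerSeries

/-- `d/dt` as a derivation of `ℂ((t))(log t)`. -/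
def ddtLogDer :=
  derivationOf ddtLog (ratDeriv_add ddt_add ddt_mul _) (ratDeriv_mul ddt_add ddt_mul _)

@[simp]
theorem ddtLogDer_apply (f : LogField) : ddtLogDer f = ddtLog f := rfl

theorem ddtLog_toLog (f : LaurentSeries ℂ) : ddtLog (toLog f) = toLog (ddt f) :=
  ratDeriv_C ddt_add ddt_mul _ f

variable {R : PowerSeries ℂ} {h0 : constantCoeff R = 0} {hne : R ≠ 0} {l : ℂ}

theorem PhiLog_toLog (f : LaurentSeries ℂ) :
    PhiLog R h0 hne l (toLog f) = toLog (Phi R h0 hne f) :=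
  ratEndo_C _ _ _ f

theorem mul_derivative_logOf {W : PowerSeries ℂ} (hW : constantCoeff W = 1) :
    W * d⁄dX ℂ (logOf W) = d⁄dX ℂ W := by
  have hs : HasSubst (W - 1) := HasSubst.of_constantCoeff_zero' (by simp [hW])
  have hlog : (1 + X) * d⁄dX ℂ (PowerSeries.log ℂ) = 1 := by
    rw [deriv_log]
    ext n
    rw [add_mul, one_mul, map_add]
    cases n with
    | zero => simp
    | succ n =>
      rw [coeff_succ_X_mul, coeff_mk, coeff_mk, coeff_one, if_neg (Nat.succ_ne_zero n), ← map_add]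
      simp [pow_succ]
  have h := congrArg (fun p : PowerSeries ℂ => p.subst (W - 1)) hlog
  have hone : (1 : PowerSeries ℂ).subst (W - 1) = (1 : PowerSeries ℂ) := by
    rw [← coe_substAlgHom hs, map_one]
  simp only [subst_mul hs, subst_add hs, hone, subst_X hs] at h
  rw [add_sub_cancel] at h
  rw [logOf_eq, derivative_subst hs, ← mul_assoc, h, one_mul, map_sub, ← map_one (C (R := ℂ)),
    derivative_C, sub_zero]

theorem logRest_chain_rule :
    HahnSeries.C (ord R : ℂ) * HahnSeries.single (-1 : ℤ) (1 : ℂ) + ddt (logRest R l) =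
      ddt (toLaurent R) * Phi R h0 hne (HahnSeries.single (-1 : ℤ) (1 : ℂ)) := by
  obtain ⟨W, hW⟩ : ∃ W, W = PowerSeries.C (leadCoeff R)⁻¹ * R.divXPowOrder := ⟨_, rfl⟩
  have hr : leadCoeff R ≠ 0 := coeff_order hne
  have hRW : R = PowerSeries.C (leadCoeff R) * X ^ ord R * W := by
    have h1 : X ^ ord R * R.divXPowOrder = R := X_pow_order_mul_divXPowOrder
    have h2 : PowerSeries.C (leadCoeff R) * PowerSeries.C (leadCoeff R)⁻¹ = 1 := by
      rw [← map_mul, mul_inv_cancel₀ hr, map_one]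
    rw [hW]
    linear_combination -h1 - X ^ ord R * R.divXPowOrder * h2
  have hW1 : constantCoeff W = 1 := by
    have h1 := congrArg (coeff (ord R)) hRW
    rw [mul_assoc, coeff_C_mul, coeff_X_pow_mul', if_pos le_rfl, Nat.sub_self,
      coeff_zero_eq_constantCoeff_apply] at h1
    change leadCoeff R = _ at h1
    exact mul_left_cancel₀ hr (by rw [← h1, mul_one])
  set t : LaurentSeries ℂ := toLaurent X with ht
  have ht0 : t ≠ 0 := (map_ne_zero_iff _ HahnSeries.ofPowerSeries_injective).mpr X_ne_zero
  have hts : HahnSeries.single (-1 : ℤ) (1 : ℂ) = t⁻¹ := by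
    apply eq_inv_of_mul_eq_one_left
    rw [ht]
    change _ * ((X : PowerSeries ℂ) : LaurentSeries ℂ) = 1
    rw [PowerSeries.coe_X, HahnSeries.single_mul_single]
    simp
  have hR0 : toLaurent R ≠ 0 := (map_ne_zero_iff _ HahnSeries.ofPowerSeries_injective).mpr hne
  rw [hts, map_inv₀, ht, Phi_toLaurent, subst_X (HasSubst.of_constantCoeff_zero' h0), ← ht,
    logRest, ddt_add, ddt_C, zero_add, ← hW, ddt_toLaurent, ddt_toLaurent]
  have hlog := congrArg toLaurent (mul_derivative_logOf hW1)
  rw [map_mul] at hlog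
  have hd : X * d⁄dX ℂ R = PowerSeries.C (ord R : ℂ) * R +
      PowerSeries.C (leadCoeff R) * X ^ (ord R) * X * d⁄dX ℂ W := by
    have hord : ∀ n : ℕ, X * d⁄dX ℂ ((X : PowerSeries ℂ) ^ n) = PowerSeries.C (n : ℂ) * X ^ n := by
      intro n
      rw [derivative_pow, derivative_X, mul_one]
      cases n with
      | zero => simp
      | succ n =>
        rw [Nat.add_sub_cancel, map_natCast]
        ring
    have h1 := congrArg (d⁄dX ℂ) hRW
    rw [Derivation.leibniz, Derivation.leibniz, derivative_C] at h1
    simp only [smul_eq_mul, mul_zero, add_zero] at h1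
    linear_combination X * h1 + W * PowerSeries.C (leadCoeff R) * hord (ord R) -
      PowerSeries.C (ord R : ℂ) * hRW
  have hd' := congrArg toLaurent hd
  have hR' := congrArg toLaurent hRW
  simp only [map_mul, map_add, map_pow] at hd' hR'
  rw [← ht] at hd' hR'
  have hC : toLaurent (PowerSeries.C (ord R : ℂ)) = HahnSeries.C (ord R : ℂ) := PowerSeries.coe_C _
  rw [hC] at hd'
  rw [← div_eq_mul_inv, ← div_eq_mul_inv, div_add' _ _ _ ht0, div_eq_div_iff ht0 hR0]
  linear_combination -hd' + toLaurent (d⁄dX ℂ (logOf W)) * t * hR' +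
    toLaurent (PowerSeries.C (leadCoeff R)) * t ^ ord R * t * hlog

theorem ddtLog_PhiLog (x : LogField) :
    ddtLog (PhiLog R h0 hne l x) =
      toLog (ddt (toLaurent R)) * PhiLog R h0 hne l (ddtLog x) := by
  have hmul : ∀ x y : LogField, ddtLog (x * y) = x * ddtLog y + y * ddtLog x :=
    ratDeriv_mul ddt_add ddt_mul _
  have hadd : ∀ x y : LogField, ddtLog (x + y) = ddtLog x + ddtLog y :=
    ratDeriv_add ddt_add ddt_mul _
  have hC : ∀ a : LaurentSeries ℂ, ddtLog (PhiLog R h0 hne l (toLog a)) =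
      toLog (ddt (toLaurent R)) * PhiLog R h0 hne l (ddtLog (toLog a)) := by
    intro a
    rw [PhiLog_toLog, ddtLog_toLog, ddtLog_toLog, PhiLog_toLog, ddt_Phi, map_mul]
  have hX : ddtLog (PhiLog R h0 hne l RatFunc.X) =
      toLog (ddt (toLaurent R)) * PhiLog R h0 hne l (ddtLog RatFunc.X) := by
    have h1 : PhiLog R h0 hne l RatFunc.X =
      toLog (HahnSeries.C (ord R : ℂ)) * RatFunc.X + toLog (logRest R l) := ratEndo_X _ _ _
    have h2 : ddtLog RatFunc.X = toLog (HahnSeries.single (-1 : ℤ) (1 : ℂ)) :=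
      ratDeriv_X ddt_add ddt_mul _
    rw [h1, hadd, hmul, ddtLog_toLog, ddtLog_toLog, h2, ddt_C, map_zero, mul_zero, add_zero,
      PhiLog_toLog, ← map_mul, ← map_mul, ← map_add, logRest_chain_rule]
  have hE : ∀ y z : LogField,
      ddtLog (PhiLog R h0 hne l y) = toLog (ddt (toLaurent R)) * PhiLog R h0 hne l (ddtLog y) →
      ddtLog (PhiLog R h0 hne l z) = toLog (ddt (toLaurent R)) * PhiLog R h0 hne l (ddtLog z) →
      ddtLog (PhiLog R h0 hne l (y * z)) =
        toLog (ddt (toLaurent R)) * PhiLog R h0 hne l (ddtLog (y * z)) := by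
    intro y z hy hz
    rw [map_mul, hmul, hy, hz, hmul, map_add, map_mul, map_mul]
    ring
  refine chain_rule_of_fraction (A := Polynomial (LaurentSeries ℂ)) (D := ddtLogDer)
    (fun p => ?_) x
  simp only [ddtLogDer_apply]
  induction p using Polynomial.induction_on with
  | C a =>
    rw [RatFunc.algebraMap_C]
    exact hC a
  | add p q hp hq => rw [map_add, map_add, hadd, hp, hq, hadd, map_add, mul_add]
  | monomial n a ih =>
    rw [pow_succ, ← mul_assoc, map_mul]
    refine hE _ _ ih ?_
    rw [RatFunc.algebraMap_X]
    exact hX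

/-- If `R'(0) = 0`, then the elements of `ℂ((t))(log t)` fixed by `Φ_R` are constant. -/
theorem exists_eq_C_of_PhiLog_eq_self (h1 : coeff 1 R = 0) {x : LogField}
    (hx : PhiLog R h0 hne l x = x) : ∃ c : ℂ, x = toLog (HahnSeries.C c) := by
  have hα := ord_cast_ne_zero R h0 hne
  have hd2 : 2 ≤ ord R := by
    by_contra! h
    have hc : coeff (ord R) R ≠ 0 := coeff_order hne
    interval_cases hn : ord R
    · exact hc (by simpa using h0)
    · exact hc h1
  set φ := Phi R h0 hne with hφ
  obtain ⟨hden, hnum⟩ := polyEndo_num_denom_of_ratEndo_eq_self φ hα (logRest R l) hx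
  set α : LaurentSeries ℂ := HahnSeries.C (ord R : ℂ) with hαdef
  set k := x.denom.natDegree with hk
  have hdC : (ord R : ℂ) ≠ 0 := Nat.cast_ne_zero.mpr (by omega)
  have key : ∀ p : Polynomial (LaurentSeries ℂ), p ≠ 0 →
      polyEndo φ α (logRest R l) p = Polynomial.C (α ^ k) * p →
        p.natDegree = k ∧ p.leadingCoeff = HahnSeries.C (p.leadingCoeff.coeff 0) := by
    intro p hp hE
    have hlc := congrArg Polynomial.leadingCoeff hE
    rw [leadingCoeff_polyEndo φ hα, Polynomial.leadingCoeff_mul, Polynomial.leadingCoeff_C] at hlc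
    have hlc' : φ p.leadingCoeff =
        HahnSeries.C ((ord R : ℂ) ^ k / (ord R : ℂ) ^ p.natDegree) * p.leadingCoeff := by
      rw [map_div₀, map_pow, map_pow, ← hαdef, div_mul_eq_mul_div,
        eq_div_iff (pow_ne_zero _ hα), hlc]
    obtain ⟨h2, h3⟩ := eq_C_of_Phi_eq_C_mul h1 (Polynomial.leadingCoeff_ne_zero.mpr hp)
      (div_ne_zero (pow_ne_zero _ hdC) (pow_ne_zero _ hdC)) hlc'
    refine ⟨?_, h3⟩
    rw [div_eq_one_iff_eq (pow_ne_zero _ hdC)] at h2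
    exact (Nat.pow_right_injective hd2 (by exact_mod_cast h2)).symm
  by_cases hx0 : x = 0
  · exact ⟨0, by rw [hx0, map_zero, map_zero]⟩
  have hnum0 : x.num ≠ 0 := RatFunc.num_ne_zero hx0
  obtain ⟨hk', hc⟩ := key _ hnum0 hnum
  set c := x.num.leadingCoeff.coeff 0 with hcdef
  have hdiff : x.num - Polynomial.C (HahnSeries.C c) * x.denom = 0 := by
    by_contra hne'
    obtain ⟨h2, -⟩ := key _ hne' (by
      have : polyEndo φ α (logRest R l) (Polynomial.C (HahnSeries.C c)) =
          Polynomial.C (HahnSeries.C c) := by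
        rw [polyEndo, Polynomial.coe_eval₂RingHom, Polynomial.eval₂_C, RingHom.comp_apply, hφ,
          Phi_C]
      rw [map_sub, map_mul, hden, hnum, this]
      ring)
    apply Polynomial.leadingCoeff_ne_zero.mpr hne'
    rw [Polynomial.leadingCoeff, h2, Polynomial.coeff_sub, Polynomial.coeff_C_mul,
      Polynomial.Monic.coeff_natDegree (RatFunc.monic_denom x), mul_one, ← hk', ← hc,
      Polynomial.coeff_natDegree, sub_self]
  refine ⟨c, ?_⟩
  rw [← RatFunc.num_div_denom x, sub_eq_zero.mp hdiff, map_mul, RatFunc.algebraMap_C,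
    mul_div_cancel_right₀ _ (RatFunc.algebraMap_ne_zero x.denom_ne_zero)]
  rfl

end LogField

section

open PowerSeries

section Rational

theorem zero_add_map (x y : ℂ) : (fun _ : ℂ => (0 : ℂ)) (x + y) = 0 + 0 := by simp

theorem zero_mul_map (x y : ℂ) : (fun _ : ℂ => (0 : ℂ)) (x * y) = x * 0 + y * 0 := by simp

/-- `d/dt` as a derivation of `ℂ(t)`. -/
def ratDer := derivationOf (ratDeriv (fun _ : ℂ => 0) 1) (ratDeriv_add zero_add_map zero_mul_map 1)
  (ratDeriv_mul zero_add_map zero_mul_map 1)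

theorem ratDer_algebraMap (p : Polynomial ℂ) :
    ratDer (algebraMap _ (RatFunc ℂ) p) = algebraMap _ (RatFunc ℂ) p.derivative := by
  have h : ratDer (algebraMap _ (RatFunc ℂ) p) = _ :=
    ratDeriv_algebraMap zero_add_map zero_mul_map 1 p
  rw [h]
  simp [polyDeriv, Polynomial.sum]

theorem ratDer_C (c : ℂ) : ratDer (RatFunc.C c) = 0 := by
  rw [← RatFunc.algebraMap_C, ratDer_algebraMap, Polynomial.derivative_C, map_zero]

theorem ratDer_X : ratDer RatFunc.X = 1 := by
  rw [← RatFunc.algebraMap_X, ratDer_algebraMap, Polynomial.derivative_X, map_one]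

theorem derivation_mul {F : Type*} [Field F] (D : Derivation ℤ F F) (x y : F) :
    D (x * y) = x * D y + y * D x := D.leibniz x y

theorem derivation_inv_pow {F : Type*} [Field F] (D : Derivation ℤ F F) (x : F) (n : ℕ) :
    D (x⁻¹ ^ (n + 1)) = -((n + 1 : ℕ) * x⁻¹ ^ (n + 2) * D x) := by
  rw [Derivation.leibniz_pow, Derivation.leibniz_inv, Nat.add_sub_cancel]
  simp only [smul_eq_mul, nsmul_eq_mul]
  ring

theorem ratDer_C_mul (c : ℂ) (x : RatFunc ℂ) :
    ratDer (RatFunc.C c * x) = RatFunc.C c * ratDer x := by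
  rw [derivation_mul, ratDer_C, mul_zero, add_zero]

theorem ratDer_X_sub_C (a : ℂ) : ratDer (RatFunc.X - RatFunc.C a) = 1 := by
  rw [map_sub, ratDer_X, ratDer_C, sub_zero]

theorem deriv_comp_of_fraction {A F E : Type*} [CommRing A] [Field F] [Algebra A F]
    [IsFractionRing A F] [Field E] {ι : F →+* E} {D : Derivation ℤ F F} {D' : Derivation ℤ E E}
    (h : ∀ a : A, D' (ι (algebraMap A F a)) = ι (D (algebraMap A F a))) (x : F) :
    D' (ι x) = ι (D x) := by
  obtain ⟨a, b, hb, rfl⟩ := IsFractionRing.div_surjective (A := A) x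
  rw [map_div₀, Derivation.leibniz_div, h, h, Derivation.leibniz_div]
  simp only [smul_eq_mul, map_mul, map_sub, map_inv₀, map_pow]

theorem ddt_ratToLaurent (q : RatFunc ℂ) : ddt (ratToLaurent q) = ratToLaurent (ratDer q) := by
  refine deriv_comp_of_fraction (A := Polynomial ℂ) (D := ratDer) (D' := ddtDer) (fun p => ?_) q
  rw [ddtDer_apply, ratToLaurent_algebraMap, ddt_toLaurent, PowerSeries.derivative_coe,
    ratDer_algebraMap, ratToLaurent_algebraMap]

/-- The automorphism `q(t) ↦ q(t + p)` of `ℂ(t)`. -/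
def translate (p : ℂ) : RatFunc ℂ →+* RatFunc ℂ := ratEndo (RingHom.id ℂ) 1 one_ne_zero p

theorem translate_algebraMap (p : ℂ) (P : Polynomial ℂ) :
    translate p (algebraMap _ (RatFunc ℂ) P) =
      algebraMap _ (RatFunc ℂ) (P.comp (Polynomial.X + Polynomial.C p)) := by
  rw [translate, ratEndo_algebraMap, polyEndo_eq_comp, Polynomial.map_id, Polynomial.C_1, one_mul]

theorem ratDer_translate (p : ℂ) (q : RatFunc ℂ) :
    ratDer (translate p q) = translate p (ratDer q) := by
  refine deriv_comp_of_fraction (A := Polynomial ℂ) (D := ratDer) (D' := ratDer) (fun P => ?_) q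
  rw [translate_algebraMap, ratDer_algebraMap, ratDer_algebraMap, translate_algebraMap,
    Polynomial.derivative_comp]
  simp

/-- The expansion of a rational function at `p`. -/
def expandAt (p : ℂ) : RatFunc ℂ →+* LaurentSeries ℂ := ratToLaurent.comp (translate p)

theorem ddt_expandAt (p : ℂ) (q : RatFunc ℂ) : ddt (expandAt p q) = expandAt p (ratDer q) := by
  rw [expandAt, RingHom.comp_apply, RingHom.comp_apply, ddt_ratToLaurent, ratDer_translate]

theorem expandAt_C (p c : ℂ) : expandAt p (RatFunc.C c) = HahnSeries.C c := by
  rw [expandAt, RingHom.comp_apply, translate, ratEndo_C, RingHom.id_apply, ratToLaurent_C]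

theorem expandAt_algebraMap (p : ℂ) (P : Polynomial ℂ) :
    expandAt p (algebraMap _ (RatFunc ℂ) P) =
      toLaurent ((P.comp (Polynomial.X + Polynomial.C p) : Polynomial ℂ) : PowerSeries ℂ) := by
  rw [expandAt, RingHom.comp_apply, translate_algebraMap, ratToLaurent_algebraMap]

theorem coeff_neg_one_ddt (x : LaurentSeries ℂ) : (ddt x).coeff (-1) = 0 := by
  rw [coeff_ddt]
  simp

theorem coeff_neg_one_toLaurent (g : PowerSeries ℂ) : (toLaurent g).coeff (-1) = 0 := by
  change (g : LaurentSeries ℂ).coeff (-1) = 0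
  rw [PowerSeries.coeff_coe, if_pos (by norm_num)]

/-- The residue of a logarithmic derivative is the order. -/
theorem coeff_neg_one_logDeriv {x : LaurentSeries ℂ} (hx : x ≠ 0) :
    (ddt x / x).coeff (-1) = (x.order : ℂ) := by
  set u := x.powerSeriesPart with hu
  have hxu : HahnSeries.single x.order 1 * toLaurent u = x := x.single_order_mul_powerSeriesPart
  have hu0 : constantCoeff u ≠ 0 := by
    rw [← coeff_zero_eq_constantCoeff_apply, hu, LaurentSeries.powerSeriesPart_coeff]
    simpa using coeff_order_ne_zero hx
  have hul : toLaurent u ≠ 0 := by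
    refine (map_ne_zero_iff _ HahnSeries.ofPowerSeries_injective).mpr ?_
    rintro h
    rw [h, map_zero] at hu0
    exact hu0 rfl
  have hinv : (toLaurent u)⁻¹ = toLaurent u⁻¹ := by
    rw [inv_eq_iff_eq_inv]
    apply eq_inv_of_mul_eq_one_left
    rw [← map_mul, PowerSeries.mul_inv_cancel _ hu0, map_one]
  have hs : HahnSeries.single (x.order - 1) (x.order : ℂ) =
      HahnSeries.single x.order (1 : ℂ) * HahnSeries.single (-1 : ℤ) (x.order : ℂ) := by
    rw [HahnSeries.single_mul_single, one_mul, sub_eq_add_neg]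
  have hdx : ddt x = HahnSeries.single x.order 1 * ddt (toLaurent u) +
      HahnSeries.single (x.order - 1) (x.order : ℂ) * toLaurent u := by
    rw [← ddt_single_mul, hxu]
  have key : ddt x / x = toLaurent (d⁄dX ℂ u * u⁻¹) + HahnSeries.single (-1 : ℤ) (x.order : ℂ) := by
    rw [hdx, hs, map_mul, ← hinv, ddt_toLaurent, div_eq_iff hx]
    have h1 : toLaurent u * (toLaurent u)⁻¹ = 1 := mul_inv_cancel₀ hul
    linear_combination (toLaurent (d⁄dX ℂ u) * (toLaurent u)⁻¹ +
      HahnSeries.single (-1 : ℤ) (x.order : ℂ)) * hxu -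
        HahnSeries.single x.order 1 * toLaurent (d⁄dX ℂ u) * h1
  rw [key, HahnSeries.coeff_add, coeff_neg_one_toLaurent, zero_add]
  simp

/-- The order of a rational function at `p`. -/
def ordAt (p : ℂ) (w : RatFunc ℂ) : ℤ := (expandAt p w).order

/-- The residue of a rational function at `p`. -/
def resAt (p : ℂ) (w : RatFunc ℂ) : ℂ := (expandAt p w).coeff (-1)

theorem resAt_add (p : ℂ) (v w : RatFunc ℂ) : resAt p (v + w) = resAt p v + resAt p w := by
  rw [resAt, map_add, HahnSeries.coeff_add]; rfl

theorem resAt_C_mul (p c : ℂ) (w : RatFunc ℂ) : resAt p (RatFunc.C c * w) = c * resAt p w := by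
  rw [resAt, map_mul, expandAt_C, HahnSeries.C_mul_eq_smul, HahnSeries.coeff_smul]; rfl

theorem resAt_sum {α : Type*} (p : ℂ) (s : Finset α) (w : α → RatFunc ℂ) :
    resAt p (∑ i ∈ s, w i) = ∑ i ∈ s, resAt p (w i) := by
  classical
  induction s using Finset.induction_on with
  | empty => simp [resAt]
  | insert a s ha ih => rw [Finset.sum_insert ha, Finset.sum_insert ha, resAt_add, ih]

theorem resAt_ratDer (p : ℂ) (w : RatFunc ℂ) : resAt p (ratDer w) = 0 := by
  rw [resAt, ← ddt_expandAt, coeff_neg_one_ddt]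

theorem resAt_logDeriv (p : ℂ) {w : RatFunc ℂ} (hw : w ≠ 0) :
    resAt p (ratDer w / w) = ordAt p w := by
  rw [resAt, map_div₀, ← ddt_expandAt, coeff_neg_one_logDeriv ((map_ne_zero _).mpr hw), ordAt]

theorem ordAt_mul (p : ℂ) {v w : RatFunc ℂ} (hv : v ≠ 0) (hw : w ≠ 0) :
    ordAt p (v * w) = ordAt p v + ordAt p w := by
  rw [ordAt, map_mul, HahnSeries.order_mul ((map_ne_zero _).mpr hv) ((map_ne_zero _).mpr hw)]; rfl

theorem ordAt_C (p c : ℂ) : ordAt p (RatFunc.C c) = 0 := by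
  rw [ordAt, expandAt_C, HahnSeries.order_C]

theorem order_zpow {x : LaurentSeries ℂ} (hx : x ≠ 0) (n : ℤ) : (x ^ n).order = n * x.order := by
  cases n with
  | ofNat n => simp
  | negSucc n =>
    rw [zpow_negSucc, order_inv (pow_ne_zero _ hx), HahnSeries.order_pow, Int.negSucc_eq]
    ring

theorem order_prod_zpow {α : Type*} (s : Finset α) {x : α → LaurentSeries ℂ}
    (hx : ∀ i ∈ s, x i ≠ 0) (n : α → ℤ) :
    (∏ i ∈ s, x i ^ n i).order = ∑ i ∈ s, n i * (x i).order := by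
  classical
  induction s using Finset.induction_on with
  | empty => simp
  | insert a s ha ih =>
    have hx' : ∀ i ∈ s, x i ≠ 0 := fun i hi => hx i (Finset.mem_insert_of_mem hi)
    have hxa := hx a (Finset.mem_insert_self a s)
    rw [Finset.prod_insert ha, Finset.sum_insert ha, HahnSeries.order_mul (zpow_ne_zero _ hxa)
      (Finset.prod_ne_zero_iff.mpr fun i hi => zpow_ne_zero _ (hx' i hi)), order_zpow hxa, ih hx']

theorem ordAt_prod_zpow {α : Type*} (p : ℂ) (s : Finset α) {w : α → RatFunc ℂ}
    (hw : ∀ i ∈ s, w i ≠ 0) (n : α → ℤ) :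
    ordAt p (∏ i ∈ s, w i ^ n i) = ∑ i ∈ s, n i * ordAt p (w i) := by
  rw [ordAt, map_prod]
  simp only [map_zpow₀]
  exact order_prod_zpow s (fun i hi => (map_ne_zero _).mpr (hw i hi)) n

theorem order_toLaurent_eq_zero_iff {g : PowerSeries ℂ} (hg : g ≠ 0) :
    (toLaurent g).order = 0 ↔ constantCoeff g ≠ 0 := by
  have hgl : toLaurent g ≠ 0 := (map_ne_zero_iff _ HahnSeries.ofPowerSeries_injective).mpr hg
  have hc : (toLaurent g).coeff 0 = constantCoeff g := by
    change (g : LaurentSeries ℂ).coeff 0 = _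
    rw [PowerSeries.coeff_coe, if_neg (by norm_num)]
    simp
  constructor
  · intro h
    have := coeff_order_ne_zero hgl
    rwa [h, hc] at this
  · intro h
    refine le_antisymm (HahnSeries.order_le_of_coeff_ne_zero (by rwa [hc])) ?_
    by_contra! hlt
    apply coeff_order_ne_zero hgl
    change (g : LaurentSeries ℂ).coeff _ = _
    rw [PowerSeries.coeff_coe, if_pos hlt]

theorem ordAt_algebraMap_eq_zero_iff (p : ℂ) {P : Polynomial ℂ} (hP : P ≠ 0) :
    ordAt p (algebraMap _ (RatFunc ℂ) P) = 0 ↔ P.eval p ≠ 0 := by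
  have h0 : P.comp (Polynomial.X + Polynomial.C p) ≠ 0 := by
    intro h
    have h1 := congrArg (fun Q => Q.comp (Polynomial.X - Polynomial.C p)) h
    simp only [Polynomial.comp_assoc, Polynomial.zero_comp] at h1
    simp at h1
    exact hP h1
  rw [ordAt, expandAt_algebraMap, order_toLaurent_eq_zero_iff]
  · rw [Polynomial.constantCoeff_coe, Polynomial.coeff_zero_eq_eval_zero, Polynomial.eval_comp]
    simp
  · exact_mod_cast h0

theorem algebraMap_X_sub_C (a : ℂ) :
    algebraMap _ (RatFunc ℂ) (Polynomial.X - Polynomial.C a) = RatFunc.X - RatFunc.C a := by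
  rw [map_sub, RatFunc.algebraMap_X, RatFunc.algebraMap_C]

theorem X_sub_C_ne_zero (a : ℂ) : (RatFunc.X - RatFunc.C a : RatFunc ℂ) ≠ 0 := by
  rw [← algebraMap_X_sub_C]
  exact RatFunc.algebraMap_ne_zero (Polynomial.X_sub_C_ne_zero a)

theorem ordAt_X_sub_C (p a : ℂ) :
    ordAt p (RatFunc.X - RatFunc.C a) = if p = a then 1 else 0 := by
  rw [← algebraMap_X_sub_C]
  split_ifs with h
  · subst h
    rw [ordAt, expandAt_algebraMap]
    simp
  · rw [ordAt_algebraMap_eq_zero_iff p (Polynomial.X_sub_C_ne_zero a)]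
    simpa [sub_eq_zero] using h

theorem expandAt_zero (q : RatFunc ℂ) : expandAt 0 q = ratToLaurent q := by
  obtain ⟨a, b, hb, rfl⟩ := IsFractionRing.div_surjective (A := Polynomial ℂ) q
  rw [map_div₀, map_div₀, expandAt_algebraMap, expandAt_algebraMap, ratToLaurent_algebraMap,
    ratToLaurent_algebraMap]
  simp

/-- A rational function without zeros and poles in `ℂ` is constant. -/
theorem eq_C_of_forall_ordAt_eq_zero {w : RatFunc ℂ} (hw : w ≠ 0) (h : ∀ p, ordAt p w = 0) :
    ∃ c : ℂ, w = RatFunc.C c := by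
  have hn0 := RatFunc.num_ne_zero hw
  have hd0 := w.denom_ne_zero
  have hord : ∀ p, ordAt p (algebraMap _ (RatFunc ℂ) w.num) =
      ordAt p (algebraMap _ (RatFunc ℂ) w.denom) := by
    intro p
    have h1 : algebraMap _ (RatFunc ℂ) w.num = w * algebraMap _ (RatFunc ℂ) w.denom := by
      rw [← div_eq_iff (RatFunc.algebraMap_ne_zero hd0), RatFunc.num_div_denom]
    rw [h1, ordAt_mul p hw (RatFunc.algebraMap_ne_zero hd0), h, zero_add]
  have hiff : ∀ p, w.num.eval p = 0 ↔ w.denom.eval p = 0 := by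
    intro p
    rw [← not_iff_not]
    change w.num.eval p ≠ 0 ↔ w.denom.eval p ≠ 0
    rw [← ordAt_algebraMap_eq_zero_iff p hn0, ← ordAt_algebraMap_eq_zero_iff p hd0, hord]
  have hnot : ∀ p, ¬ (w.num.eval p = 0 ∧ w.denom.eval p = 0) := by
    rintro p ⟨h1, h2⟩
    obtain ⟨a, b, hab⟩ := RatFunc.isCoprime_num_denom w
    have := congrArg (Polynomial.eval p) hab
    simp [h1, h2] at this
  have hconst : ∀ P : Polynomial ℂ, (∀ p, P.eval p ≠ 0) → ∃ c, P = Polynomial.C c := by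
    intro P hP
    refine ⟨P.coeff 0, Polynomial.eq_C_of_degree_le_zero ?_⟩
    by_contra! hdeg
    obtain ⟨p, hp⟩ := IsAlgClosed.exists_root P hdeg.ne'
    exact hP p hp
  obtain ⟨a, ha⟩ := hconst w.num fun p hp => hnot p ⟨hp, (hiff p).mp hp⟩
  obtain ⟨b, hb⟩ := hconst w.denom fun p hp => hnot p ⟨(hiff p).mpr hp, hp⟩
  refine ⟨a / b, ?_⟩
  rw [← RatFunc.num_div_denom w, ha, hb, RatFunc.algebraMap_C, RatFunc.algebraMap_C, map_div₀]

end Rational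

section PartialFractions

/-- The functions of the form `g' + ∑ c_a / (t - a)`. -/
def HasLogPrimitive (h : RatFunc ℂ) : Prop :=
  ∃ (g : RatFunc ℂ) (c : ℂ →₀ ℂ),
    h = ratDer g + c.sum fun a z => RatFunc.C z * (RatFunc.X - RatFunc.C a)⁻¹

theorem HasLogPrimitive.add {h k : RatFunc ℂ} (hh : HasLogPrimitive h) (hk : HasLogPrimitive k) :
    HasLogPrimitive (h + k) := by
  classical
  obtain ⟨g, c, rfl⟩ := hh
  obtain ⟨g', c', rfl⟩ := hk
  refine ⟨g + g', c + c', ?_⟩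
  rw [map_add, Finsupp.sum_add_index' (by simp) (by intros; rw [map_add, add_mul])]
  ring

theorem HasLogPrimitive.ratDer (g : RatFunc ℂ) : HasLogPrimitive (ratDer g) := ⟨g, 0, by simp⟩

theorem HasLogPrimitive.zero : HasLogPrimitive 0 := by
  simpa using HasLogPrimitive.ratDer 0

theorem HasLogPrimitive.sum {α : Type*} (s : Finset α) {h : α → RatFunc ℂ}
    (hh : ∀ i ∈ s, HasLogPrimitive (h i)) : HasLogPrimitive (∑ i ∈ s, h i) := by
  classical
  induction s using Finset.induction_on with
  | empty => simpa using HasLogPrimitive.zero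
  | insert a s ha ih =>
    rw [Finset.sum_insert ha]
    exact (hh a (Finset.mem_insert_self a s)).add
      (ih fun i hi => hh i (Finset.mem_insert_of_mem hi))

theorem hasLogPrimitive_polynomial (p : Polynomial ℂ) :
    HasLogPrimitive (algebraMap _ (RatFunc ℂ) p) := by
  induction p using Polynomial.induction_on' with
  | add p q hp hq => rw [map_add]; exact hp.add hq
  | monomial n a =>
    have h : algebraMap _ (RatFunc ℂ) (Polynomial.monomial n a) =
        IterFE.ratDer (algebraMap _ (RatFunc ℂ) (Polynomial.monomial (n + 1) (a / (n + 1)))) := by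
      rw [ratDer_algebraMap, Polynomial.derivative_monomial, Nat.add_sub_cancel]
      congr 2
      have : (n : ℂ) + 1 ≠ 0 := Nat.cast_add_one_ne_zero n
      push_cast
      field_simp
    rw [h]
    exact HasLogPrimitive.ratDer _

theorem hasLogPrimitive_pole (z a : ℂ) (n : ℕ) :
    HasLogPrimitive (RatFunc.C z * (RatFunc.X - RatFunc.C a)⁻¹ ^ (n + 1)) := by
  cases n with
  | zero => exact ⟨0, Finsupp.single a z, by simp⟩
  | succ n =>
    have hn : (n : ℂ) + 1 ≠ 0 := Nat.cast_add_one_ne_zero n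
    have h : RatFunc.C z * (RatFunc.X - RatFunc.C a)⁻¹ ^ (n + 1 + 1) =
        IterFE.ratDer (RatFunc.C (-z / (n + 1)) * (RatFunc.X - RatFunc.C a)⁻¹ ^ (n + 1)) := by
      rw [ratDer_C_mul, derivation_inv_pow, ratDer_X_sub_C, mul_one]
      have : RatFunc.C (-z / (n + 1)) * ((n + 1 : ℕ) : RatFunc ℂ) = - RatFunc.C z := by
        rw [← map_natCast (RatFunc.C (K := ℂ)), ← map_mul, ← map_neg]
        congr 1
        push_cast
        field_simp
      linear_combination (RatFunc.X - RatFunc.C a)⁻¹ ^ (n + 2) * this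
    rw [h]
    exact HasLogPrimitive.ratDer _

theorem hasLogPrimitive (h : RatFunc ℂ) : HasLogPrimitive h := by
  classical
  set s := h.denom.roots.toFinset with hs
  have hden : h.denom = ∏ a ∈ s, (Polynomial.X - Polynomial.C a) ^ h.denom.roots.count a := by
    rw [hs, ← Finset.prod_multiset_map_count]
    exact (IsAlgClosed.splits h.denom).eq_prod_roots_of_monic h.monic_denom
  obtain ⟨q, r, hr, hqr⟩ := Polynomial.mul_prod_pow_inverse_eq_quo_add_sum_rem_mul_pow_inverse
    (K := RatFunc ℂ) (s := s) h.num (g := fun a => Polynomial.X - Polynomial.C a)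
    (fun a _ => Polynomial.monic_X_sub_C a)
    (fun a _ b _ hab => Polynomial.isCoprime_X_sub_C_of_isUnit_sub
      (sub_ne_zero.mpr hab).isUnit)
    (fun a => h.denom.roots.count a) (gi := fun a => (RatFunc.X - RatFunc.C a)⁻¹)
    (fun a _ => by rw [algebraMap_X_sub_C, inv_mul_cancel₀ (X_sub_C_ne_zero a)])
  have hh : h = algebraMap _ (RatFunc ℂ) h.num *
      ∏ a ∈ s, (RatFunc.X - RatFunc.C a)⁻¹ ^ h.denom.roots.count a := by
    conv_lhs =>
      rw [← RatFunc.num_div_denom h, div_eq_mul_inv, hden, map_prod, ← Finset.prod_inv_distrib]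
    congr 1
    refine Finset.prod_congr rfl fun a _ => ?_
    rw [map_pow, algebraMap_X_sub_C, inv_pow]
  rw [hh, hqr]
  refine (hasLogPrimitive_polynomial q).add (HasLogPrimitive.sum s fun a ha =>
    HasLogPrimitive.sum _ fun j _ => ?_)
  have hrj := hr a ha j
  rw [Polynomial.degree_X_sub_C] at hrj
  rw [Polynomial.eq_C_of_degree_le_zero (Nat.WithBot.lt_one_iff_le_zero.mp hrj),
    RatFunc.algebraMap_C]
  exact hasLogPrimitive_pole _ a j

end PartialFractions

end

section

open PowerSeries

section Conclusion

/-- Every complex linear relation `∑ c_a m_a = 0` with integers `m_a` is satisfied by suitable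
integers `n_a`, not all zero, in place of the `c_a`. -/
theorem exists_int_relations {c : ℂ →₀ ℂ} (hc : c ≠ 0) :
    ∃ n : ℂ → ℤ, (∃ a ∈ c.support, n a ≠ 0) ∧
      ∀ m : ℂ → ℤ, ∑ a ∈ c.support, c a * (m a : ℂ) = 0 → ∑ a ∈ c.support, n a * m a = 0 := by
  obtain ⟨a₀, ha₀⟩ := Finsupp.support_nonempty_iff.mpr hc
  have hca₀ : c a₀ ∉ (⊥ : Submodule ℚ ℂ) := by
    rw [Submodule.mem_bot]
    exact Finsupp.mem_support_iff.mp ha₀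
  obtain ⟨ℓ, hℓ, -⟩ := Submodule.exists_le_ker_of_notMem hca₀
  obtain ⟨N, hN⟩ := IsLocalization.exist_integer_multiples (nonZeroDivisors ℤ) c.support
    fun a => ℓ (c a)
  have hN0 : ((N : ℤ) : ℚ) ≠ 0 := Int.cast_ne_zero.mpr (nonZeroDivisors.coe_ne_zero N)
  have hex : ∀ a, ∃ k : ℤ, (k : ℚ) = (N : ℤ) * ℓ (c a) := by
    intro a
    by_cases ha : a ∈ c.support
    · obtain ⟨k, hk⟩ := hN a ha
      exact ⟨k, by simpa [zsmul_eq_mul] using hk⟩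
    · exact ⟨0, by rw [Finsupp.notMem_support_iff.mp ha]; simp⟩
  choose n hn using hex
  refine ⟨n, ⟨a₀, ha₀, ?_⟩, ?_⟩
  · intro h
    have := hn a₀
    rw [h, Int.cast_zero] at this
    exact mul_ne_zero hN0 hℓ this.symm
  · intro m hm
    have h1 := congrArg ℓ hm
    rw [map_sum, map_zero] at h1
    have h2 : ∀ a, ℓ (c a * (m a : ℂ)) = ℓ (c a) * m a := by
      intro a
      have : c a * (m a : ℂ) = (m a : ℚ) • c a := by
        rw [Rat.smul_def, mul_comm]
        push_cast
        rfl
      rw [this, map_smul, smul_eq_mul, mul_comm]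
    simp only [h2] at h1
    have h3 : ((∑ a ∈ c.support, n a * m a : ℤ) : ℚ) = (N : ℤ) * ∑ a ∈ c.support, ℓ (c a) * m a := by
      push_cast
      rw [Finset.mul_sum]
      refine Finset.sum_congr rfl fun a _ => ?_
      rw [hn]
      ring
    rw [h1, mul_zero] at h3
    exact_mod_cast h3

variable {R : PowerSeries ℂ} {h0 : constantCoeff R = 0} {hne : R ≠ 0}

/-- A solution of `Φ_R(f) = f + b` with a rational derivative is rational. -/
theorem isRational_of_ddt_isRational (hrat : IsRational (toLaurent R))
    (hiter : ∀ n : ℕ, 1 ≤ n → iter R n ≠ X) {f : LaurentSeries ℂ} {b : RatFunc ℂ}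
    (hf : Phi R h0 hne f = f + ratToLaurent b) (hd : IsRational (ddt f)) : IsRational f := by
  obtain ⟨h, hh⟩ := hd
  obtain ⟨g, c, hgc⟩ := hasLogPrimitive h
  have hconst : c = 0 → IsRational f := by
    rintro rfl
    rw [Finsupp.sum_zero_index, add_zero] at hgc
    have h1 : ddt (f - ratToLaurent g) = 0 := by
      have : ddt (f - ratToLaurent g) = ddt f - ddt (ratToLaurent g) :=
        map_sub (LaurentSeries.derivative ℂ) _ _
      rw [this, ddt_ratToLaurent, ← hgc, hh, sub_self]
    refine ⟨g + RatFunc.C ((f - ratToLaurent g).coeff 0), ?_⟩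
    rw [map_add, ratToLaurent_C, ← eq_C_of_ddt_eq_zero h1]
    ring
  by_contra hfr
  have hc : c ≠ 0 := fun h => hfr (hconst h)
  obtain ⟨ρ, hρ⟩ := id hrat
  have hinj : Function.Injective ratToLaurent := ratToLaurent.injective
  set x : ℂ → RatFunc ℂ := fun a => RatFunc.X - RatFunc.C a with hx
  set w : ℂ → RatFunc ℂ := fun a => ρ - RatFunc.C a with hw
  have hΦx : ∀ a, Phi R h0 hne (ratToLaurent (x a)) = ratToLaurent (w a) := by
    intro a
    rw [hx, hw, map_sub, map_sub, map_sub, ratToLaurent_C, Phi_C, hρ, ← RatFunc.algebraMap_X,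
      ratToLaurent_algebraMap, Polynomial.coe_X, Phi_toLaurent,
      subst_X (HasSubst.of_constantCoeff_zero' h0)]
  have hx0 : ∀ a, x a ≠ 0 := X_sub_C_ne_zero
  have hw0 : ∀ a, w a ≠ 0 := by
    intro a ha
    have := hΦx a
    rw [ha, map_zero, _root_.map_eq_zero, _root_.map_eq_zero] at this
    exact hx0 a this
  have hgc' : h = ratDer g + ∑ a ∈ c.support, RatFunc.C (c a) * (ratDer (x a) / x a) := by
    rw [hgc, Finsupp.sum]
    congr 1
    refine Finset.sum_congr rfl fun a _ => ?_
    rw [hx, ratDer_X_sub_C, one_div]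
  have h0supp : (0 : ℂ) ∉ c.support := by
    intro h0mem
    have h1 : resAt 0 h = 0 := by
      rw [resAt, expandAt_zero, hh, coeff_neg_one_ddt]
    rw [hgc', resAt_add, resAt_ratDer, zero_add, resAt_sum,
      Finset.sum_eq_single_of_mem 0 h0mem] at h1
    · rw [resAt_C_mul, resAt_logDeriv 0 (hx0 0), hx, ordAt_X_sub_C, if_pos rfl] at h1
      exact Finsupp.mem_support_iff.mp h0mem (by simpa using h1)
    · intro a _ ha
      rw [resAt_C_mul, resAt_logDeriv 0 (hx0 a), hx, ordAt_X_sub_C, if_neg ha.symm]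
      simp
  obtain ⟨g₁, hg₁⟩ := exists_ratToLaurent_Phi (h0 := h0) (hne := hne) hrat g
  have hrel : ratDer g₁ + ∑ a ∈ c.support, RatFunc.C (c a) * (ratDer (w a) / w a) =
      h + ratDer b := by
    apply hinj
    have e1 : ddt (Phi R h0 hne f) = ratToLaurent (h + ratDer b) := by
      rw [hf, ddt_add, ← hh, ddt_ratToLaurent, map_add]
    have e2 : ∀ q q', Phi R h0 hne (ratToLaurent q) = ratToLaurent q' →
        ratToLaurent (ratDer q') =
          ddt (toLaurent R) * Phi R h0 hne (ratToLaurent (ratDer q)) := by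
      intro q q' hq
      rw [← ddt_ratToLaurent, ← hq, ddt_Phi, ddt_ratToLaurent]
    rw [← e1, ddt_Phi, ← hh, hgc']
    simp only [map_add, map_sum, map_mul, map_div₀, ratToLaurent_C, Phi_C, e2 _ _ hg₁,
      e2 _ _ (hΦx _), hΦx, mul_add, Finset.mul_sum]
    congr 1
    refine Finset.sum_congr rfl fun a _ => ?_
    ring
  have hordrel : ∀ p, ∑ a ∈ c.support, c a * ((ordAt p (w a) - ordAt p (x a) : ℤ) : ℂ) = 0 := by
    intro p
    have h1 := congrArg (resAt p) hrel
    rw [hgc', resAt_add, resAt_add, resAt_add, resAt_ratDer, resAt_ratDer, resAt_ratDer, zero_add,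
      zero_add, add_zero, resAt_sum, resAt_sum, ← sub_eq_zero, ← Finset.sum_sub_distrib] at h1
    rw [← h1]
    refine Finset.sum_congr rfl fun a _ => ?_
    rw [resAt_C_mul, resAt_C_mul, resAt_logDeriv p (hw0 a), resAt_logDeriv p (hx0 a)]
    push_cast
    ring
  obtain ⟨n, ⟨a₀, ha₀, hna₀⟩, hn⟩ := exists_int_relations hc
  set u := ∏ a ∈ c.support, x a ^ n a with hu
  set v := ∏ a ∈ c.support, w a ^ n a with hv
  have hu0 : u ≠ 0 := Finset.prod_ne_zero_iff.mpr fun a _ => zpow_ne_zero _ (hx0 a)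
  have hv0 : v ≠ 0 := Finset.prod_ne_zero_iff.mpr fun a _ => zpow_ne_zero _ (hw0 a)
  have hΦu : Phi R h0 hne (ratToLaurent u) = ratToLaurent v := by
    rw [hu, hv]
    simp only [map_prod, map_zpow₀, hΦx]
  have hord : ∀ p, ordAt p (v / u) = 0 := by
    intro p
    have h1 := ordAt_mul p (div_ne_zero hv0 hu0) hu0
    rw [div_mul_cancel₀ _ hu0, hv, hu, ordAt_prod_zpow p _ fun a _ => hw0 a,
      ordAt_prod_zpow p _ fun a _ => hx0 a] at h1
    have h2 := hn _ (hordrel p)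
    simp only [mul_sub, Finset.sum_sub_distrib] at h2
    rw [hu, hv]
    omega
  obtain ⟨κ, hκ⟩ := eq_C_of_forall_ordAt_eq_zero (div_ne_zero hv0 hu0) hord
  rw [div_eq_iff hu0] at hκ
  have hordu : ∀ p, ordAt p u = ∑ a ∈ c.support, n a * if p = a then 1 else 0 := by
    intro p
    rw [hu, ordAt_prod_zpow p _ fun a _ => hx0 a]
    simp only [hx, ordAt_X_sub_C]
  have hu0' : ratToLaurent u ≠ 0 := (map_ne_zero _).mpr hu0
  have hΦu' : Phi R h0 hne (ratToLaurent u) = HahnSeries.C κ * ratToLaurent u := by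
    rw [hΦu, hκ, map_mul, ratToLaurent_C]
  have hκ1 : κ = 1 := by
    refine eq_one_of_Phi_eq_of_order_eq_zero hu0' ?_ hΦu'
    rw [← expandAt_zero]
    change ordAt 0 u = 0
    rw [hordu]
    refine Finset.sum_eq_zero fun a ha => ?_
    rw [if_neg, mul_zero]
    rintro rfl
    exact h0supp ha
  rw [hκ1, map_one, one_mul] at hΦu'
  have huC := eq_C_of_Phi_eq_self hiter hΦu'
  rw [← ratToLaurent_C] at huC
  have h1 := hordu a₀
  rw [hinj huC, ordAt_C, Finset.sum_eq_single_of_mem a₀ ha₀, if_pos rfl, mul_one] at h1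
  · exact hna₀ h1.symm
  · intro a _ ha
    rw [if_neg ha.symm, mul_zero]

theorem diffAlgebraic_comp_iff {K F E : Type*} [Field K] [Field F] [Field E] {ι : K →+* F}
    (j : F →+* E) {D : F → F} {D' : E → E} (h : ∀ x, D' (j x) = j (D x)) {f : F} :
    DiffAlgebraic (j.comp ι) D' (j f) ↔ DiffAlgebraic ι D f := by
  have hit : ∀ i : ℕ, D'^[i] (j f) = j (D^[i] f) := fun i =>
    ((Function.Semiconj.iterate_right (f := j) (fun x => (h x).symm) i) f).symm
  refine exists_congr fun n => exists_congr fun P => and_congr_right fun _ => ?_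
  simp only [hit]
  rw [show (MvPolynomial.eval₂ (j.comp ι) (fun i : Fin (n + 1) => j (D^[(i : ℕ)] f)) P) =
    j (MvPolynomial.eval₂ ι (fun i : Fin (n + 1) => D^[(i : ℕ)] f) P) from
      (MvPolynomial.hom_eval₂ P ι j _).symm, _root_.map_eq_zero]

/-- The main step in terms of `DiffAlgebraic`. -/
theorem exists_eq_or_exists_deriv_eq {K F : Type*} [Field K] [CharZero K] [Field F] {ι : K →+* F}
    (φ : F →+* F) (D : Derivation ℤ F F) (hφK : ∀ a, ∃ a', φ (ι a) = ι a')
    (hDK : ∀ a, ∃ a', D (ι a) = ι a') (hfix : ∀ x, φ x = x → ∃ a, ι a = x) (r : K)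
    (hchain : ∀ x, D (φ x) = ι r * φ (D x)) {Ψ f : F} {b : K} (hΨ : φ Ψ = ι r * Ψ)
    (hΨt : DiffTranscendental ι D Ψ) (hf : φ f = f + ι b) (hfa : DiffAlgebraic ι D f) :
    (∃ a, ι a = f) ∨ ∃ a, ι a = D f := by
  let := ι.toAlgebra
  exact mem_or_deriv_mem φ D hφK hDK hfix r hchain hΨ
    (not_not.mp (mt diffAlgebraic_iff.mpr hΨt)) hf (diffAlgebraic_iff.mp hfa)

end Conclusion

end

end IterFE

end

theorem mainTheorem5
    (R : PowerSeries ℂ)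
    (hrat : IterFE.IsRational (IterFE.toLaurent R))
    (h0 : PowerSeries.constantCoeff R = 0)
    (hne : R ≠ 0)
    (hiter : ∀ n : ℕ, 1 ≤ n → IterFE.iter R n ≠ PowerSeries.X)
    (hΨ :
      (PowerSeries.coeff 1 R ≠ 0 ∧
        ∃ Ψ : LaurentSeries ℂ,
          IterFE.Phi R h0 hne Ψ = IterFE.ddt (IterFE.toLaurent R) * Ψ ∧
          IterFE.DiffTranscendental IterFE.ratToLaurent IterFE.ddt Ψ) ∨
      (PowerSeries.coeff 1 R = 0 ∧
        ∃ l : ℂ, Complex.exp l = IterFE.leadCoeff R ∧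
        ∃ Ψ : IterFE.LogField,
          IterFE.PhiLog R h0 hne l Ψ =
            IterFE.toLog (IterFE.ddt (IterFE.toLaurent R)) * Ψ ∧
          IterFE.DiffTranscendental (IterFE.toLog.comp IterFE.ratToLaurent) IterFE.ddtLog Ψ))
    (b : RatFunc ℂ) (f : LaurentSeries ℂ)
    (hf : IterFE.Phi R h0 hne f = f + IterFE.ratToLaurent b) :
    IterFE.IsRational f ∨ IterFE.DiffTranscendental IterFE.ratToLaurent IterFE.ddt f := by
  by_cases hfa : IterFE.DiffAlgebraic IterFE.ratToLaurent IterFE.ddt f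
  swap
  · exact Or.inr hfa
  left
  obtain ⟨r, hr⟩ : ∃ r, IterFE.ddt (IterFE.toLaurent R) = IterFE.ratToLaurent r := by
    obtain ⟨ρ, hρ⟩ := hrat
    rw [← hρ]
    exact IterFE.exists_ratToLaurent_ddt ρ
  suffices h : IterFE.IsRational f ∨ IterFE.IsRational (IterFE.ddt f) from
    h.elim id (IterFE.isRational_of_ddt_isRational hrat hiter hf)
  rcases hΨ with ⟨-, Ψ, hΨ, hΨt⟩ | ⟨h1, l, -, Ψ, hΨ, hΨt⟩
  · refine IterFE.exists_eq_or_exists_deriv_eq (IterFE.Phi R h0 hne) IterFE.ddtDer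
      (IterFE.exists_ratToLaurent_Phi hrat) IterFE.exists_ratToLaurent_ddt (fun x hx => ?_) r
      (fun x => ?_) (hΨ.trans (by rw [hr])) hΨt hf hfa
    · exact ⟨RatFunc.C (x.coeff 0), by
        rw [IterFE.ratToLaurent_C, ← IterFE.eq_C_of_Phi_eq_self hiter hx]⟩
    · rw [← hr]
      exact IterFE.ddt_Phi x
  · have hinj : Function.Injective IterFE.toLog := IterFE.toLog.injective
    have hmain := IterFE.exists_eq_or_exists_deriv_eq (ι := IterFE.toLog.comp IterFE.ratToLaurent)
      (IterFE.PhiLog R h0 hne l) IterFE.ddtLogDer (f := IterFE.toLog f) (b := b)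
      (fun a => ?_) (fun a => ?_) (fun x hx => ?_) r
      (fun x => ?_) (hΨ.trans (by rw [hr]; rfl)) hΨt ?_
      ((IterFE.diffAlgebraic_comp_iff IterFE.toLog IterFE.ddtLog_toLog).mpr hfa)
    · refine hmain.imp ?_ ?_
      · rintro ⟨a, ha⟩
        exact ⟨a, hinj ha⟩
      · rintro ⟨a, ha⟩
        rw [IterFE.ddtLogDer_apply, IterFE.ddtLog_toLog] at ha
        exact ⟨a, hinj ha⟩
    · obtain ⟨a', ha'⟩ := IterFE.exists_ratToLaurent_Phi (h0 := h0) (hne := hne) hrat a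
      exact ⟨a', by rw [RingHom.comp_apply, RingHom.comp_apply, IterFE.PhiLog_toLog, ha']⟩
    · obtain ⟨a', ha'⟩ := IterFE.exists_ratToLaurent_ddt a
      exact ⟨a', by
        rw [RingHom.comp_apply, RingHom.comp_apply, IterFE.ddtLogDer_apply, IterFE.ddtLog_toLog,
          ha']⟩
    · obtain ⟨c, rfl⟩ := IterFE.exists_eq_C_of_PhiLog_eq_self h1 hx
      exact ⟨RatFunc.C c, by rw [RingHom.comp_apply, IterFE.ratToLaurent_C]⟩
    · rw [RingHom.comp_apply, ← hr]
      exact IterFE.ddtLog_PhiLog x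
    · rw [IterFE.PhiLog_toLog, hf, map_add, RingHom.comp_apply]
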